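/- Let $N$ be a free abelian group of finite rank, $M=\mathrm{Hom}(N,\mathbb Z)$, and let $\Sigma$ be a unimodular fan in $N_{\mathbb R}$: a finite set of rational cones, closed under taking faces, any two of which meet in a common face, containing the cone $\{0\}$, and such that each cone is generated by part of a $\mathbb Z$-basis of $N$. For a ray $\rho\in\Sigma(1)$ let $u_\rho$ be its primitive generator. Let $\mathrm{PL}(\Sigma)$ be the group of functions on $|\Sigma|$ that agree on each cone with an element of $M$, and let $\underline{\mathrm{PL}}(\Sigma)$ be its quotient by the restrictions of elements of $M$. Let $\delta_\rho\in\mathrm{PL}(\Sigma)$ be the function with $\delta_\rho(u_\rho)=1$ and $\delta_\rho(u_{\rho'})=0$ for $\rho'\ne\rho$. Let $\Sigma^\rho$ be the star fan at $\rho$ in $N^\rho_{\mathbb R}$, where $N^\rho=N/\mathrm{Span}_{\mathbb Z}(\rho\cap N)$, and let $[f]^\rho\in\underline{\mathrm{PL}}(\Sigma^\rho)$ be the class induced by $f-m$, where $m\in M$ agrees with $f$ on $\rho$. The fan $\Sigma$ is called Ehrhart if, recursively, every star fan $\Sigma^\rho$ ($\rho\in\Sigma(1)$) is Ehrhart with Ehrhart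 polynomial $\chi_{\Sigma^\rho}$, and there is a function $\chi_\Sigma:\underline{\mathrm{PL}}(\Sigma)\to\mathbb Z$, called the Ehrhart polynomial of $\Sigma$, with $\chi_\Sigma(0)=1$ and $$\chi_\Sigma([f])=\chi_\Sigma([f-\delta_\rho])+\chi_{\Sigma^\rho}([f]^\rho)\qquad\text{for all } f\in\mathrm{PL}(\Sigma),\ \rho\in\Sigma(1).$$ Let $A^*(\Sigma)=\mathbb Z[x_\rho\mid\rho\in\Sigma(1)]/(\mathcal J_1+\mathcal J_2)$ be the Chow ring, graded by polynomial degree, where $\mathcal J_1$ is generated by the products $x_{\rho_1}\cdots x_{\rho_k}$ over rays that do not lie on a common cone of $\Sigma$, and $\mathcal J_2$ by the linear forms $\sum_\rho m(u_\rho)x_\rho$ with $m\in M$. A class $[f]\in\underline{\mathrm{PL}}(\Sigma)$ is identified with the class of $\sum_\rho f(u_\rho)x_\rho$ in $A^1(\Sigma)$. Let $\Sigma$ be an Ehrhart fan of dimension $d$ with Ehrhart polynomial $\chi_\Sigma$. Then: 1. There is exactly one group homomorphism $\deg:A^d(\Sigma)\to\mathbb Z$ with $\deg(x_{\rho_1}\cdots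 x_{\rho_d})=1$ whenever $\rho_1,\dots,\rho_d$ are the rays of a $d$-dimensional cone of $\Sigma$. Let $V_\Sigma([f])=\deg([f]^d)$ be the resulting volume polynomial. 2. There is exactly one polynomial $P\in\mathbb Q[x_\rho\mid\rho\in\Sigma(1)]$ whose value at $(f(u_\rho))_\rho$ is $\chi_\Sigma([f])$ for all $f\in\mathrm{PL}(\Sigma)$. It has degree exactly $d$, and its homogeneous part of degree $d$ is $\frac1{d!}V_\Sigma$; that is, the value of that part at $(f(u_\rho))_\rho$ is $\frac{1}{d!}V_\Sigma([f])$ for every $f\in\mathrm{PL}(\Sigma)$. -/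

import Mathlib

open scoped TensorProduct

universe u

namespace EhrhartFan

noncomputable section

/-! ### Lattices, rational cones and rational fans -/

/-- The real vector space `N_ℝ = ℝ ⊗ N` of a lattice `N`. -/
abbrev RealSpace (N : Type u) [AddCommGroup N] : Type u := ℝ ⊗[ℤ] N

/-- The lattice point `n ∈ N`, viewed in `N_ℝ`. -/
def lat {N : Type u} [AddCommGroup N] (n : N) : RealSpace N := (1 : ℝ) ⊗ₜ[ℤ] n

/-- The element `m` of the dual lattice `M = Hom(N, ℤ)`, viewed as a linear function on `N_ℝ`. -/
def realForm {N : Type u} [AddCommGroup N] (m : Module.Dual ℤ N) : RealSpace N →ₗ[ℝ] ℝ :=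
  (TensorProduct.AlgebraTensorModule.rid ℤ ℝ ℝ).toLinearMap ∘ₗ LinearMap.baseChange ℝ m

/-- A rational cone: a finite intersection of closed rational halfspaces. -/
def IsRationalCone {N : Type u} [AddCommGroup N] (σ : Set (RealSpace N)) : Prop :=
  ∃ T : Finset (Module.Dual ℤ N), σ = {v | ∀ m ∈ T, 0 ≤ realForm m v}

/-- `τ` is a face of `σ`: `τ = σ ∩ H_m` for some `m ∈ M` whose open halfspace misses `σ`. -/
def IsFace {N : Type u} [AddCommGroup N] (τ σ : Set (RealSpace N)) : Prop :=
  ∃ m : Module.Dual ℤ N,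
    σ ∩ {v | 0 < realForm m v} = ∅ ∧ τ = σ ∩ {v | 0 ≤ realForm m v}

/-- A rational fan in `N_ℝ`. -/
structure IsRationalFan {N : Type u} [AddCommGroup N] (F : Set (Set (RealSpace N))) : Prop where
  finite : F.Finite
  rational : ∀ σ ∈ F, IsRationalCone σ
  face_mem : ∀ σ ∈ F, ∀ τ, IsFace τ σ → τ ∈ F
  inter_face : ∀ σ₁ ∈ F, ∀ σ₂ ∈ F, IsFace (σ₁ ∩ σ₂) σ₁ ∧ IsFace (σ₁ ∩ σ₂) σ₂

/-- The dimension of a cone: the dimension of its linear span. -/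
def coneDim {N : Type u} [AddCommGroup N] (σ : Set (RealSpace N)) : ℕ :=
  Module.finrank ℝ (Submodule.span ℝ σ)

/-- The dimension of a fan: the largest dimension of a cone in it. -/
def fanDim {N : Type u} [AddCommGroup N] (F : Set (Set (RealSpace N))) : ℕ :=
  sSup (coneDim '' F)

/-- The type `Σ(1)` of rays of a fan. -/
abbrev Ray {N : Type u} [AddCommGroup N] (F : Set (Set (RealSpace N))) : Type u :=
  {ρ : Set (RealSpace N) // ρ ∈ F ∧ coneDim ρ = 1}

/-- The cone generated by the lattice points `b i`, `i ∈ S`. -/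
def genCone {N : Type u} [AddCommGroup N] {ι : Type} (b : ι → N) (S : Finset ι) :
    Set (RealSpace N) :=
  {v | ∃ c : ι → ℝ, (∀ i, 0 ≤ c i) ∧ v = ∑ i ∈ S, c i • lat (b i)}

/-- A unimodular cone: a cone generated by a part of a `ℤ`-basis of `N`. -/
def IsUnimodularCone {N : Type u} [AddCommGroup N] (σ : Set (RealSpace N)) : Prop :=
  ∃ (b : Module.Basis (Fin (Module.finrank ℤ N)) ℤ N) (S : Finset (Fin (Module.finrank ℤ N))),
    σ = genCone b S

/-- A unimodular fan: a rational fan which is pointed (contains the origin as a cone) and all of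
whose cones are unimodular. -/
structure IsUnimodularFan {N : Type u} [AddCommGroup N] (F : Set (Set (RealSpace N))) : Prop
    extends IsRationalFan F where
  pointed : {0} ∈ F
  unimodular : ∀ σ ∈ F, IsUnimodularCone σ

/-- `u` is the generator of the monoid `ρ ∩ N`. -/
def IsRayGenerator {N : Type u} [AddCommGroup N] (ρ : Set (RealSpace N)) (u : N) : Prop :=
  (AddSubmonoid.closure {u} : Set N) = {n | lat n ∈ ρ}

/-! ### Star fans -/

/-- The neighborhood of `σ` in the fan. -/
def neighborhood {N : Type u} [AddCommGroup N] (F : Set (Set (RealSpace N)))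
    (σ : Set (RealSpace N)) : Set (Set (RealSpace N)) :=
  {τ | τ ∈ F ∧ ∃ σ' ∈ F, IsFace σ σ' ∧ IsFace τ σ'}

/-- The subgroup of `N` spanned by `σ ∩ N`. -/
def coneLattice {N : Type u} [AddCommGroup N] (σ : Set (RealSpace N)) : Submodule ℤ N :=
  Submodule.span ℤ {n | lat n ∈ σ}

/-- The quotient lattice `N^σ`. -/
abbrev StarLattice {N : Type u} [AddCommGroup N] (σ : Set (RealSpace N)) : Type u :=
  N ⧸ coneLattice σ

/-- The quotient map `N_ℝ → N^σ_ℝ`. -/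
def starProj {N : Type u} [AddCommGroup N] (σ : Set (RealSpace N)) :
    RealSpace N →ₗ[ℝ] RealSpace (StarLattice σ) :=
  LinearMap.baseChange ℝ (coneLattice σ).mkQ

/-- The star fan `Σ^σ`: the images of the cones in the neighborhood of `σ`. -/
def starFan {N : Type u} [AddCommGroup N] (F : Set (Set (RealSpace N)))
    (σ : Set (RealSpace N)) : Set (Set (RealSpace (StarLattice σ))) :=
  (fun τ => starProj σ '' τ) '' neighborhood F σ

/-! ### Integral piecewise-linear functions -/

/-- The support `|Σ|`. -/
def support {N : Type u} [AddCommGroup N] (F : Set (Set (RealSpace N))) : Set (RealSpace N) :=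
  ⋃₀ F

/-- The group `PL(Σ)` of integral piecewise-linear functions on the fan. -/
def PL {N : Type u} [AddCommGroup N] (F : Set (Set (RealSpace N))) :
    AddSubgroup (support F → ℝ) where
  carrier := {f | ∀ σ ∈ F, ∃ m : Module.Dual ℤ N,
    ∀ x : support F, (x : RealSpace N) ∈ σ → f x = realForm m x}
  zero_mem' := fun _ _ => ⟨0, fun x _ => by simp [realForm]⟩
  add_mem' := fun {f g} hf hg σ hσ => by
    obtain ⟨m, hm⟩ := hf σ hσ
    obtain ⟨m', hm'⟩ := hg σ hσ
    exact ⟨m + m', fun x hx => by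
      simp [realForm, LinearMap.baseChange_add, hm x hx, hm' x hx]⟩
  neg_mem' := fun {f} hf σ hσ => by
    obtain ⟨m, hm⟩ := hf σ hσ
    exact ⟨-m, fun x hx => by simp [realForm, LinearMap.baseChange_neg, hm x hx]⟩

lemma realForm_add {N : Type u} [AddCommGroup N] (m m' : Module.Dual ℤ N) :
    realForm (m + m') = realForm m + realForm m' := by
  ext; simp [realForm]

lemma realForm_lat {N : Type u} [AddCommGroup N] (m : Module.Dual ℤ N) (n : N) :
    realForm m (lat n) = (m n : ℝ) := by
  simp [realForm, lat]

/-- The restriction `m ↦ m|_{|Σ|}` from `M` to `PL(Σ)`. -/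
def restrictLinear {N : Type u} [AddCommGroup N] (F : Set (Set (RealSpace N))) :
    Module.Dual ℤ N →+ PL F where
  toFun m := ⟨fun x => realForm m x, fun _ _ => ⟨m, fun _ _ => rfl⟩⟩
  map_zero' := by ext x; simp [realForm]
  map_add' m m' := by ext x; simp [realForm_add]

/-- The group `L(Σ)` of integral linear functions on the fan. -/
def linearFunctions {N : Type u} [AddCommGroup N] (F : Set (Set (RealSpace N))) :
    AddSubgroup (PL F) :=
  (restrictLinear F).range

/-- The group of integral piecewise-linear functions up to translation. -/
abbrev UPL {N : Type u} [AddCommGroup N] (F : Set (Set (RealSpace N))) : Type u :=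
  PL F ⧸ linearFunctions F

/-- The class `[f]`. -/
abbrev cls {N : Type u} [AddCommGroup N] {F : Set (Set (RealSpace N))} : PL F →+ UPL F :=
  QuotientAddGroup.mk' (linearFunctions F)

/-! ### Restriction of piecewise-linear functions to star fans -/

lemma IsRationalCone.add_mem {N : Type u} [AddCommGroup N] {σ : Set (RealSpace N)}
    (h : IsRationalCone σ) {v w : RealSpace N} (hv : v ∈ σ) (hw : w ∈ σ) : v + w ∈ σ := by
  obtain ⟨T, rfl⟩ := h
  intro m hm
  rw [map_add]
  exact add_nonneg (hv m hm) (hw m hm)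

lemma IsRationalCone.smul_mem {N : Type u} [AddCommGroup N] {σ : Set (RealSpace N)}
    (h : IsRationalCone σ) {v : RealSpace N} (hv : v ∈ σ) {r : ℝ} (hr : 0 ≤ r) : r • v ∈ σ := by
  obtain ⟨T, rfl⟩ := h
  intro m hm
  rw [map_smul, smul_eq_mul]
  exact mul_nonneg hr (hv m hm)

lemma IsRationalCone.zero_mem {N : Type u} [AddCommGroup N] {σ : Set (RealSpace N)}
    (h : IsRationalCone σ) : (0 : RealSpace N) ∈ σ := by
  obtain ⟨T, rfl⟩ := h
  intro m hm
  simp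

lemma IsFace.subset {N : Type u} [AddCommGroup N] {τ σ : Set (RealSpace N)} (h : IsFace τ σ) :
    τ ⊆ σ := by
  obtain ⟨m, -, rfl⟩ := h
  exact Set.inter_subset_left

lemma exists_sub_of_starProj_eq_zero {N : Type u} [AddCommGroup N] {σ : Set (RealSpace N)}
    (h : IsRationalCone σ) {v : RealSpace N} (hv : starProj σ v = 0) :
    ∃ s ∈ σ, ∃ t ∈ σ, v = s - t := by
  let D : Submodule ℝ (RealSpace N) :=
    { carrier := {v | ∃ s ∈ σ, ∃ t ∈ σ, v = s - t}
      zero_mem' := ⟨0, h.zero_mem, 0, h.zero_mem, by simp⟩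
      add_mem' := by
        rintro _ _ ⟨s, hs, t, ht, rfl⟩ ⟨s', hs', t', ht', rfl⟩
        exact ⟨s + s', h.add_mem hs hs', t + t', h.add_mem ht ht', (add_sub_add_comm s s' t t').symm⟩
      smul_mem' := by
        rintro r _ ⟨s, hs, t, ht, rfl⟩
        rcases le_total 0 r with hr | hr
        · exact ⟨r • s, h.smul_mem hs hr, r • t, h.smul_mem ht hr, smul_sub _ _ _⟩
        · refine ⟨(-r) • t, h.smul_mem ht (by linarith), (-r) • s,
            h.smul_mem hs (by linarith), ?_⟩
          rw [smul_sub, neg_smul, neg_smul, neg_sub_neg] }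
  have hlat : ∀ n ∈ coneLattice σ, lat n ∈ D := by
    intro n hn
    induction hn using Submodule.span_induction with
    | mem x hx => exact ⟨lat x, hx, 0, h.zero_mem, by simp⟩
    | zero => simp [lat]
    | add x y _ _ hx hy =>
      have : lat (x + y) = lat x + lat y := by simp [lat, TensorProduct.tmul_add]
      rw [this]; exact D.add_mem hx hy
    | smul a x _ hx =>
      have : lat (a • x) = (a : ℝ) • lat x := by
        simp [lat, TensorProduct.smul_tmul']
      rw [this]; exact D.smul_mem _ hx
  have hex := lTensor_exact ℝ (LinearMap.exact_subtype_mkQ (coneLattice σ))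
    (Submodule.mkQ_surjective _)
  obtain ⟨w, rfl⟩ := (hex v).1 hv
  change _ ∈ D
  induction w using TensorProduct.induction_on with
  | zero => simp
  | add x y hx hy =>
    rw [map_add]
    refine D.add_mem (hx ?_) (hy ?_)
    · exact (hex _).2 ⟨x, rfl⟩
    · exact (hex _).2 ⟨y, rfl⟩
  | tmul r n =>
    have : (LinearMap.lTensor ℝ (coneLattice σ).subtype) (r ⊗ₜ[ℤ] n) = r • lat (n : N) := by
      simp [lat, TensorProduct.smul_tmul']
    rw [this]
    exact D.smul_mem _ (hlat n n.2)

lemma realForm_liftQ {N : Type u} [AddCommGroup N] {σ : Set (RealSpace N)}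
    (m : Module.Dual ℤ N) (hm : coneLattice σ ≤ LinearMap.ker m) (v : RealSpace N) :
    realForm ((coneLattice σ).liftQ m hm) (starProj σ v) = realForm m v := by
  induction v using TensorProduct.induction_on with
  | zero => simp
  | add x y hx hy => rw [map_add, map_add, map_add, hx, hy]
  | tmul r n => simp [realForm, starProj]

lemma coneLattice_le_ker {N : Type u} [AddCommGroup N] {σ : Set (RealSpace N)}
    {m : Module.Dual ℤ N} (h : ∀ v ∈ σ, realForm m v = 0) :
    coneLattice σ ≤ LinearMap.ker m := by
  refine Submodule.span_le.2 fun n hn => ?_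
  have := h _ hn
  rw [realForm_lat] at this
  exact_mod_cast this

/-- The piecewise-linear functions vanishing on `σ`. -/
def vanishingOn {N : Type u} [AddCommGroup N] (F : Set (Set (RealSpace N)))
    (σ : Set (RealSpace N)) : AddSubgroup (PL F) where
  carrier := {g | ∀ x : support F, (x : RealSpace N) ∈ σ → g.1 x = 0}
  zero_mem' := fun _ _ => rfl
  add_mem' := fun {f g} hf hg x hx => by simp [hf x hx, hg x hx]
  neg_mem' := fun {f} hf x hx => by simp [hf x hx]

lemma eq_of_starProj_eq {N : Type u} [AddCommGroup N] {F : Set (Set (RealSpace N))}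
    (hF : IsRationalFan F) {σ : Set (RealSpace N)} (hσ : σ ∈ F) {g : PL F}
    (hg : g ∈ vanishingOn F σ) {x y : support F} {τ₁ τ₂ : Set (RealSpace N)}
    (h₁ : τ₁ ∈ neighborhood F σ) (h₂ : τ₂ ∈ neighborhood F σ)
    (hx : (x : RealSpace N) ∈ τ₁) (hy : (y : RealSpace N) ∈ τ₂)
    (hxy : starProj σ x = starProj σ y) : g.1 x = g.1 y := by
  obtain ⟨-, σ₁, hσ₁, hs₁, ht₁⟩ := h₁
  obtain ⟨-, σ₂, hσ₂, hs₂, ht₂⟩ := h₂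
  obtain ⟨s, hs, t, ht, hst⟩ := exists_sub_of_starProj_eq_zero (hF.rational σ hσ)
    (v := (x : RealSpace N) - y) (by rw [map_sub, hxy, sub_self])
  have key : ∀ σ' ∈ F, σ ⊆ σ' → ∀ z : support F, (z : RealSpace N) ∈ σ' → ∀ w ∈ σ,
      ∃ h : (z : RealSpace N) + w ∈ support F, g.1 ⟨z + w, h⟩ = g.1 z := by
    intro σ' hσ' hsub z hz w hw
    have hmem := (hF.rational σ' hσ').add_mem hz (hsub hw)
    refine ⟨⟨σ', hσ', hmem⟩, ?_⟩
    obtain ⟨m, hm⟩ := g.2 σ' hσ'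
    have h0 := hg ⟨w, ⟨σ, hσ, hw⟩⟩ hw
    rw [hm _ (hsub hw)] at h0
    rw [hm _ hmem, hm _ hz, map_add, h0, add_zero]
  obtain ⟨h1, e1⟩ := key σ₁ hσ₁ hs₁.subset x (ht₁.subset hx) t ht
  obtain ⟨h2, e2⟩ := key σ₂ hσ₂ hs₂.subset y (ht₂.subset hy) s hs
  rw [← e1, ← e2]
  rw [sub_eq_sub_iff_add_eq_add] at hst
  exact congrArg g.1 (Subtype.ext (hst.trans (add_comm _ _)))

lemma exists_lift_of_mem_support {N : Type u} [AddCommGroup N] {F : Set (Set (RealSpace N))}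
    {σ : Set (RealSpace N)} (y : support (starFan F σ)) :
    ∃ x : support F, (∃ τ ∈ neighborhood F σ, (x : RealSpace N) ∈ τ) ∧ starProj σ x = y := by
  obtain ⟨y, _, ⟨τ, hτ, rfl⟩, x, hx, rfl⟩ := y
  exact ⟨⟨x, τ, hτ.1, hx⟩, ⟨τ, hτ, hx⟩, rfl⟩

/-- The function on the support of the star fan induced by a function on the support. -/
def descendFun {N : Type u} [AddCommGroup N] {F : Set (Set (RealSpace N))}
    (σ : Set (RealSpace N)) (g : support F → ℝ) : support (starFan F σ) → ℝ :=
  fun y => g (exists_lift_of_mem_support y).choose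

lemma descendFun_apply {N : Type u} [AddCommGroup N] {F : Set (Set (RealSpace N))}
    (hF : IsRationalFan F) {σ : Set (RealSpace N)} (hσ : σ ∈ F) {g : PL F}
    (hg : g ∈ vanishingOn F σ) (y : support (starFan F σ)) (x : support F)
    {τ : Set (RealSpace N)} (hτ : τ ∈ neighborhood F σ) (hx : (x : RealSpace N) ∈ τ)
    (hxy : starProj σ x = y) : descendFun σ g.1 y = g.1 x := by
  obtain ⟨⟨τ', hτ', hx'⟩, e⟩ := (exists_lift_of_mem_support y).choose_spec
  exact eq_of_starProj_eq hF hσ hg hτ' hτ hx' hx (e.trans hxy.symm)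

/-- The function `g^σ ∈ PL(Σ^σ)` induced by a function `g ∈ PL(Σ)` vanishing on `σ`; its value at
the image of `x` is `g x` (see `descendFun_apply`). -/
def descend {N : Type u} [AddCommGroup N] {F : Set (Set (RealSpace N))}
    (hF : IsRationalFan F) {σ : Set (RealSpace N)} (hσ : σ ∈ F) :
    vanishingOn F σ →+ PL (starFan F σ) where
  toFun g := ⟨descendFun σ g.1.1, by
    rintro _ ⟨τ, hτ, rfl⟩
    obtain ⟨hτF, σ', hσ', hs, ht⟩ := id hτ
    obtain ⟨m, hm⟩ := g.1.2 σ' hσ'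
    have hker : coneLattice σ ≤ LinearMap.ker m := coneLattice_le_ker fun v hv => by
      rw [← hm ⟨v, σ, hσ, hv⟩ (hs.subset hv)]
      exact g.2 _ hv
    refine ⟨(coneLattice σ).liftQ m hker, ?_⟩
    rintro y ⟨x, hx, hxy⟩
    rw [descendFun_apply hF hσ g.2 y ⟨x, τ, hτF, hx⟩ hτ hx hxy, ← hxy, realForm_liftQ]
    exact hm _ (ht.subset hx)⟩
  map_zero' := rfl
  map_add' _ _ := rfl

lemma exists_agree {N : Type u} [AddCommGroup N] {F : Set (Set (RealSpace N))}
    {σ : Set (RealSpace N)} (hσ : σ ∈ F) (f : PL F) :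
    ∃ m : Module.Dual ℤ N, f - restrictLinear F m ∈ vanishingOn F σ := by
  obtain ⟨m, hm⟩ := f.2 σ hσ
  exact ⟨m, fun x hx => by simpa [restrictLinear, sub_eq_zero] using hm x hx⟩

lemma cls_descend_restrictLinear {N : Type u} [AddCommGroup N] {F : Set (Set (RealSpace N))}
    (hF : IsRationalFan F) {σ : Set (RealSpace N)} (hσ : σ ∈ F) (m : Module.Dual ℤ N)
    (hm : restrictLinear F m ∈ vanishingOn F σ) :
    cls (descend hF hσ ⟨restrictLinear F m, hm⟩) = 0 := by
  have hker : coneLattice σ ≤ LinearMap.ker m :=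
    coneLattice_le_ker fun v hv => hm ⟨v, σ, hσ, hv⟩ hv
  refine (QuotientAddGroup.eq_zero_iff _).2 ⟨(coneLattice σ).liftQ m hker, ?_⟩
  ext y
  obtain ⟨x, ⟨τ, hτ, hx⟩, hxy⟩ := exists_lift_of_mem_support y
  refine Eq.trans ?_ (descendFun_apply hF hσ hm y x hτ hx hxy).symm
  change realForm _ (y : RealSpace (StarLattice σ)) = realForm m x
  rw [← hxy, realForm_liftQ]

/-- The class `[(f - m)^σ]` does not depend on the linear function `m` agreeing with `f` on `σ`. -/
lemma cls_descend_eq {N : Type u} [AddCommGroup N] {F : Set (Set (RealSpace N))}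
    (hF : IsRationalFan F) {σ : Set (RealSpace N)} (hσ : σ ∈ F) (f : PL F)
    (m m' : Module.Dual ℤ N) (hm : f - restrictLinear F m ∈ vanishingOn F σ)
    (hm' : f - restrictLinear F m' ∈ vanishingOn F σ) :
    cls (descend hF hσ ⟨_, hm⟩) = cls (descend hF hσ ⟨_, hm'⟩) := by
  have hd : restrictLinear F (m' - m) ∈ vanishingOn F σ := by
    have := (vanishingOn F σ).sub_mem hm hm'
    rwa [sub_sub_sub_cancel_left, ← map_sub] at this
  have e : (⟨_, hm⟩ : vanishingOn F σ) = ⟨_, hm'⟩ + ⟨_, hd⟩ := by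
    apply Subtype.ext
    change _ = (f - restrictLinear F m') + restrictLinear F (m' - m)
    rw [map_sub, sub_add_sub_cancel]
  rw [e, map_add, map_add, cls_descend_restrictLinear, add_zero]

/-- The homomorphism `[f] ↦ [f]^σ = [(f - m)^σ]`, where `m ∈ M` is any linear function that
agrees with `f` on `σ`. -/
def starClass {N : Type u} [AddCommGroup N] {F : Set (Set (RealSpace N))}
    (hF : IsRationalFan F) {σ : Set (RealSpace N)} (hσ : σ ∈ F) :
    UPL F →+ UPL (starFan F σ) :=
  QuotientAddGroup.lift (linearFunctions F)
    { toFun := fun f => cls (descend hF hσ ⟨_, (exists_agree hσ f).choose_spec⟩)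
      map_zero' := by
        rw [cls_descend_eq hF hσ 0 _ 0 _ (by simp), ← map_zero cls, ← map_zero (descend hF hσ)]
        congr 2
        simp
      map_add' := fun f g => by
        have hf := (exists_agree hσ f).choose_spec
        have hg := (exists_agree hσ g).choose_spec
        have e : f + g - restrictLinear F ((exists_agree hσ f).choose +
            (exists_agree hσ g).choose) = (f - restrictLinear F (exists_agree hσ f).choose) +
            (g - restrictLinear F (exists_agree hσ g).choose) := by
          rw [map_add, add_sub_add_comm]
        rw [cls_descend_eq hF hσ (f + g) _ ((exists_agree hσ f).choose +
          (exists_agree hσ g).choose) _ (by rw [e]; exact AddSubgroup.add_mem _ hf hg),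
          ← map_add, ← map_add]
        congr 2
        exact Subtype.ext e }
    (by
      rintro _ ⟨m, rfl⟩
      change cls _ = 0
      rw [cls_descend_eq hF hσ (restrictLinear F m) _ m _ (by simp), ← map_zero cls,
        ← map_zero (descend hF hσ)]
      congr 2
      simp)

lemma starClass_cls {N : Type u} [AddCommGroup N] {F : Set (Set (RealSpace N))}
    (hF : IsRationalFan F) {σ : Set (RealSpace N)} (hσ : σ ∈ F) (f : PL F)
    (m : Module.Dual ℤ N) (hm : f - restrictLinear F m ∈ vanishingOn F σ) :
    starClass hF hσ (cls f) = cls (descend hF hσ ⟨f - restrictLinear F m, hm⟩) :=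
  cls_descend_eq hF hσ f _ m _ hm

/-! ### Unimodular fans: ray generators and `PL(Σ) = ℤ^{Σ(1)}` -/

lemma lat_add {N : Type u} [AddCommGroup N] (n n' : N) : lat (n + n') = lat n + lat n' := by
  simp [lat, TensorProduct.tmul_add]

lemma lat_nsmul {N : Type u} [AddCommGroup N] (k : ℕ) (n : N) :
    lat (k • n) = (k : ℝ) • lat n := by
  induction k with
  | zero => simp [lat]
  | succ k ih => rw [succ_nsmul, lat_add, ih, Nat.cast_succ, add_smul, one_smul]

lemma realForm_coord {N : Type u} [AddCommGroup N] {ι : Type} (b : Module.Basis ι ℤ N)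
    (S : Finset ι) (c : ι → ℝ) (i : ι) (hi : i ∈ S) :
    realForm (b.coord i) (∑ j ∈ S, c j • lat (b j)) = c i := by
  classical
  rw [map_sum, Finset.sum_eq_single i]
  · simp [realForm_lat]
  · intro j _ hj
    simp [realForm_lat, hj]
  · exact fun h => absurd hi h

lemma realForm_coord_of_notMem {N : Type u} [AddCommGroup N] {ι : Type}
    (b : Module.Basis ι ℤ N) (S : Finset ι) (c : ι → ℝ) (i : ι) (hi : i ∉ S) :
    realForm (b.coord i) (∑ j ∈ S, c j • lat (b j)) = 0 := by
  classical
  rw [map_sum, Finset.sum_eq_zero]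
  intro j hj
  have : j ≠ i := fun h => hi (h ▸ hj)
  simp [realForm_lat, this]

lemma lat_mem_genCone {N : Type u} [AddCommGroup N] {ι : Type} (b : ι → N) {S : Finset ι}
    {i : ι} (hi : i ∈ S) : lat (b i) ∈ genCone b S := by
  classical
  refine ⟨fun j => if j = i then 1 else 0, fun j => by dsimp only; split_ifs <;> norm_num, ?_⟩
  rw [Finset.sum_eq_single i]
  · simp
  · intro j _ hj; simp [hj]
  · exact fun h => absurd hi h

lemma genCone_mono {N : Type u} [AddCommGroup N] {ι : Type} (b : ι → N) {T S : Finset ι}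
    (h : T ⊆ S) : genCone b T ⊆ genCone b S := by
  classical
  rintro _ ⟨c, hc, rfl⟩
  refine ⟨fun i => if i ∈ T then c i else 0, fun i => by dsimp only; split_ifs <;> simp [hc], ?_⟩
  simp only [ite_smul, zero_smul]
  rw [Finset.sum_ite_mem, Finset.inter_eq_right.2 h]

lemma genCone_eq_of_isFace {N : Type u} [AddCommGroup N] {ι : Type} (b : ι → N) (S : Finset ι)
    {τ : Set (RealSpace N)} (h : IsFace τ (genCone b S)) : ∃ T ⊆ S, τ = genCone b T := by
  classical
  obtain ⟨m, hm, rfl⟩ := h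
  have hle : ∀ v ∈ genCone b S, realForm m v ≤ 0 := fun v hv => by
    by_contra hlt
    exact (Set.eq_empty_iff_forall_notMem.1 hm v) ⟨hv, not_le.1 hlt⟩
  refine ⟨S.filter fun i => m (b i) = 0, Finset.filter_subset _ _, ?_⟩
  apply Set.Subset.antisymm
  · rintro _ ⟨⟨c, hc, rfl⟩, h0⟩
    refine ⟨c, hc, ?_⟩
    rw [Finset.sum_filter]
    refine Finset.sum_congr rfl fun i hi => ?_
    split_ifs with hmi
    · rfl
    · have hterm : ∀ j ∈ S, realForm m (c j • lat (b j)) ≤ 0 := fun j hj => by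
        rw [map_smul, smul_eq_mul]
        exact mul_nonpos_of_nonneg_of_nonpos (hc j) (hle _ (lat_mem_genCone b hj))
      have hsum : ∑ j ∈ S, realForm m (c j • lat (b j)) = 0 :=
        le_antisymm (Finset.sum_nonpos hterm) (by rw [← map_sum]; exact h0)
      have := (Finset.sum_eq_zero_iff_of_nonpos hterm).1 hsum i hi
      rw [map_smul, smul_eq_mul, realForm_lat] at this
      have hci : c i = 0 := by
        rcases mul_eq_zero.1 this with h | h
        · exact h
        · exact absurd (by exact_mod_cast h) hmi
      rw [hci, zero_smul]
  · intro v hv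
    refine ⟨genCone_mono b (Finset.filter_subset _ _) hv, ?_⟩
    obtain ⟨c, hc, rfl⟩ := hv
    change 0 ≤ realForm m _
    rw [map_sum]
    refine Finset.sum_nonneg fun i hi => ?_
    rw [map_smul, realForm_lat, (Finset.mem_filter.1 hi).2]
    simp

lemma isFace_genCone {N : Type u} [AddCommGroup N] {ι : Type} (b : Module.Basis ι ℤ N)
    {T S : Finset ι} (h : T ⊆ S) : IsFace (genCone b T) (genCone b S) := by
  classical
  have hval : ∀ c : ι → ℝ, realForm (-∑ i ∈ S \ T, b.coord i) (∑ j ∈ S, c j • lat (b j)) =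
      -∑ i ∈ S \ T, c i := by
    intro c
    rw [map_sum]
    have : ∀ j ∈ S, realForm (-∑ i ∈ S \ T, b.coord i) (c j • lat (b j)) =
        if j ∈ S \ T then -c j else 0 := by
      intro j hj
      rw [map_smul, realForm_lat]
      simp only [LinearMap.neg_apply, LinearMap.sum_apply, Module.Basis.coord_apply,
        Module.Basis.repr_self, Finsupp.single_apply, Finset.sum_ite_eq]
      split_ifs <;> simp
    rw [Finset.sum_congr rfl this, Finset.sum_ite_mem,
      Finset.inter_eq_right.2 Finset.sdiff_subset, Finset.sum_neg_distrib]
  refine ⟨-∑ i ∈ S \ T, b.coord i, ?_, ?_⟩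
  · rw [Set.eq_empty_iff_forall_notMem]
    rintro _ ⟨⟨c, hc, rfl⟩, hpos⟩
    rw [Set.mem_ofPred_eq, hval] at hpos
    have := Finset.sum_nonneg fun i (_ : i ∈ S \ T) => hc i
    linarith
  · apply Set.Subset.antisymm
    · intro v hv
      refine ⟨genCone_mono b h hv, ?_⟩
      obtain ⟨c, hc, rfl⟩ := hv
      change 0 ≤ realForm _ _
      rw [map_sum]
      refine Finset.sum_nonneg fun j hj => ?_
      rw [map_smul, realForm_lat]
      simp [Finsupp.single_apply, hj]
    · rintro _ ⟨⟨c, hc, rfl⟩, h0⟩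
      rw [Set.mem_ofPred_eq, hval] at h0
      have hz : ∑ i ∈ S \ T, c i = 0 :=
        le_antisymm (by linarith) (Finset.sum_nonneg fun i _ => hc i)
      rw [Finset.sum_eq_zero_iff_of_nonneg fun i _ => hc i] at hz
      refine ⟨c, hc, (Finset.sum_subset h fun i hi hiT => ?_).symm⟩
      rw [hz i (Finset.mem_sdiff.2 ⟨hi, hiT⟩), zero_smul]

lemma coneDim_genCone {N : Type u} [AddCommGroup N] {ι : Type} (b : Module.Basis ι ℤ N)
    (S : Finset ι) : coneDim (genCone b S) = S.card := by
  classical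
  have hspan : Submodule.span ℝ (genCone b S) =
      Submodule.span ℝ (Set.range fun i : S => lat (b i)) := by
    apply le_antisymm
    · rw [Submodule.span_le]
      rintro _ ⟨c, -, rfl⟩
      exact Submodule.sum_mem _ fun i hi =>
        Submodule.smul_mem _ _ (Submodule.subset_span ⟨⟨i, hi⟩, rfl⟩)
    · rw [Submodule.span_le]
      rintro _ ⟨i, rfl⟩
      exact Submodule.subset_span (lat_mem_genCone b i.2)
  have hli : LinearIndependent ℝ (fun i : S => lat (b i)) := by
    have : (fun i : S => lat (b i)) = (fun i => b.baseChange ℝ i) ∘ (fun i : S => (i : ι)) := by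
      ext i; simp [lat]
    rw [this]
    exact (b.baseChange ℝ).linearIndependent.comp _ Subtype.val_injective
  rw [coneDim, hspan, finrank_span_eq_card hli, Fintype.card_coe]

lemma isRayGenerator_genCone {N : Type u} [AddCommGroup N] {ι : Type} (b : Module.Basis ι ℤ N)
    (i : ι) : IsRayGenerator (genCone b {i}) (b i) := by
  classical
  ext n
  simp only [SetLike.mem_coe, AddSubmonoid.mem_closure_singleton, Set.mem_ofPred_eq]
  constructor
  · rintro ⟨k, rfl⟩
    exact ⟨fun _ => k, fun _ => by positivity, by simp [lat_nsmul]⟩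
  · rintro ⟨c, hc, hn⟩
    have hcoord : ∀ j, j ≠ i → b.coord j n = 0 := fun j hj => by
      have := realForm_coord_of_notMem b {i} c j (by simpa using hj)
      rw [← hn, realForm_lat] at this
      exact_mod_cast this
    have hi : ((b.coord i n : ℤ) : ℝ) = c i := by
      have := realForm_coord b {i} c i (by simp)
      rwa [← hn, realForm_lat] at this
    have hnn : 0 ≤ b.coord i n := by
      have := hc i
      rw [← hi] at this
      exact_mod_cast this
    refine ⟨(b.coord i n).toNat, ?_⟩
    apply b.ext_elem
    intro j
    rw [map_nsmul, Finsupp.smul_apply, b.repr_self, Finsupp.single_apply]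
    by_cases hj : j = i
    · subst hj
      simp at hnn ⊢
      exact hnn
    · have := hcoord j hj
      rw [Module.Basis.coord_apply] at this
      rw [if_neg (Ne.symm hj), this, smul_zero]

lemma isRayGenerator_unique {N : Type u} [AddCommGroup N] {ι : Type} (b : Module.Basis ι ℤ N)
    (i : ι) {u : N} (hu : IsRayGenerator (genCone b {i}) u) : u = b i := by
  classical
  have h : (AddSubmonoid.closure {u} : Set N) = AddSubmonoid.closure {b i} :=
    hu.trans (isRayGenerator_genCone b i).symm
  have h' : AddSubmonoid.closure {u} = AddSubmonoid.closure {b i} := SetLike.coe_injective h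
  obtain ⟨k, hk⟩ : ∃ k : ℕ, k • b i = u := AddSubmonoid.mem_closure_singleton.1
    (h' ▸ (AddSubmonoid.subset_closure rfl))
  obtain ⟨l, hl⟩ : ∃ l : ℕ, l • u = b i := AddSubmonoid.mem_closure_singleton.1
    (h'.symm ▸ (AddSubmonoid.subset_closure rfl))
  have h1 := congrArg (fun n => b.repr n i) hl
  simp only [← hk, map_nsmul, Finsupp.smul_apply, b.repr_self, Finsupp.single_eq_same,
    nsmul_eq_mul, mul_one] at h1
  have h2 : l * k = 1 := by exact_mod_cast h1
  rw [← hk, Nat.eq_one_of_mul_eq_one_left h2, one_nsmul]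

/-- A ray of a unimodular fan is generated by a basis vector. -/
lemma IsUnimodularFan.ray_eq {N : Type u} [AddCommGroup N] {F : Set (Set (RealSpace N))}
    (hF : IsUnimodularFan F) (ρ : Ray F) :
    ∃ (b : Module.Basis (Fin (Module.finrank ℤ N)) ℤ N) (i : Fin (Module.finrank ℤ N)),
      ρ.1 = genCone b {i} := by
  obtain ⟨b, S, h⟩ := hF.unimodular _ ρ.2.1
  have h1 := ρ.2.2
  rw [h, coneDim_genCone] at h1
  obtain ⟨i, rfl⟩ := Finset.card_eq_one.1 h1
  exact ⟨b, i, h⟩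

lemma IsUnimodularFan.existsUnique_rayGenerator {N : Type u} [AddCommGroup N]
    {F : Set (Set (RealSpace N))} (hF : IsUnimodularFan F) (ρ : Ray F) :
    ∃! u : N, IsRayGenerator ρ.1 u := by
  obtain ⟨b, i, h⟩ := hF.ray_eq ρ
  rw [h]
  exact ⟨b i, isRayGenerator_genCone b i, fun u hu => isRayGenerator_unique b i hu⟩

/-- The ray generator `u_ρ`: the unique element generating the monoid `ρ ∩ N`. -/
def rayGenerator {N : Type u} [AddCommGroup N] {F : Set (Set (RealSpace N))}
    (hF : IsUnimodularFan F) (ρ : Ray F) : N :=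
  (hF.existsUnique_rayGenerator ρ).choose

lemma rayGenerator_spec {N : Type u} [AddCommGroup N] {F : Set (Set (RealSpace N))}
    (hF : IsUnimodularFan F) (ρ : Ray F) : IsRayGenerator ρ.1 (rayGenerator hF ρ) :=
  (hF.existsUnique_rayGenerator ρ).choose_spec.1

lemma rayGenerator_mem {N : Type u} [AddCommGroup N] {F : Set (Set (RealSpace N))}
    (hF : IsUnimodularFan F) (ρ : Ray F) : lat (rayGenerator hF ρ) ∈ ρ.1 := by
  have : rayGenerator hF ρ ∈ {n | lat n ∈ ρ.1} := by
    rw [← rayGenerator_spec hF ρ]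
    exact (AddSubmonoid.subset_closure rfl)
  exact this

/-- The ray generator as a point of the support. -/
def rayPoint {N : Type u} [AddCommGroup N] {F : Set (Set (RealSpace N))}
    (hF : IsUnimodularFan F) (ρ : Ray F) : support F :=
  ⟨lat (rayGenerator hF ρ), ρ.1, ρ.2.1, rayGenerator_mem hF ρ⟩

lemma exists_int_eq {N : Type u} [AddCommGroup N] {F : Set (Set (RealSpace N))}
    (hF : IsUnimodularFan F) (f : PL F) (ρ : Ray F) :
    ∃ k : ℤ, (k : ℝ) = f.1 (rayPoint hF ρ) := by
  obtain ⟨m, hm⟩ := f.2 ρ.1 ρ.2.1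
  refine ⟨m (rayGenerator hF ρ), ?_⟩
  rw [hm (rayPoint hF ρ) (rayGenerator_mem hF ρ)]
  exact (realForm_lat m _).symm

/-- The integer `f(u_ρ)`. -/
def rayValue {N : Type u} [AddCommGroup N] {F : Set (Set (RealSpace N))}
    (hF : IsUnimodularFan F) (f : PL F) (ρ : Ray F) : ℤ :=
  (exists_int_eq hF f ρ).choose

lemma rayValue_spec {N : Type u} [AddCommGroup N] {F : Set (Set (RealSpace N))}
    (hF : IsUnimodularFan F) (f : PL F) (ρ : Ray F) :
    (rayValue hF f ρ : ℝ) = f.1 (rayPoint hF ρ) :=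
  (exists_int_eq hF f ρ).choose_spec

/-- Every generator of a cone of a unimodular fan is the generator of a ray of the fan. -/
lemma IsUnimodularFan.exists_ray {N : Type u} [AddCommGroup N] {F : Set (Set (RealSpace N))}
    (hF : IsUnimodularFan F) (b : Module.Basis (Fin (Module.finrank ℤ N)) ℤ N)
    {S : Finset (Fin (Module.finrank ℤ N))} (hS : genCone b S ∈ F)
    {i : Fin (Module.finrank ℤ N)} (hi : i ∈ S) :
    ∃ ρ : Ray F, ρ.1 = genCone b {i} ∧ ρ.1 ⊆ genCone b S ∧ rayGenerator hF ρ = b i := by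
  have hface : IsFace (genCone b {i}) (genCone b S) := isFace_genCone b (by simpa using hi)
  let ρ : Ray F := ⟨genCone b {i}, hF.face_mem _ hS _ hface, by simp [coneDim_genCone]⟩
  exact ⟨ρ, rfl, hface.subset, isRayGenerator_unique b i (rayGenerator_spec hF ρ)⟩

/-- Every ray of a unimodular fan contained in a given cone is spanned by a generator of it. -/
lemma IsUnimodularFan.ray_eq_of_subset {N : Type u} [AddCommGroup N]
    {F : Set (Set (RealSpace N))} (hF : IsUnimodularFan F)
    (b : Module.Basis (Fin (Module.finrank ℤ N)) ℤ N)
    {S : Finset (Fin (Module.finrank ℤ N))} (hS : genCone b S ∈ F) (ρ : Ray F)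
    (hρ : ρ.1 ⊆ genCone b S) : ∃ i ∈ S, ρ.1 = genCone b {i} ∧ rayGenerator hF ρ = b i := by
  have hface := (hF.inter_face _ ρ.2.1 _ hS).2
  rw [Set.inter_eq_left.2 hρ] at hface
  obtain ⟨T, hT, h⟩ := genCone_eq_of_isFace b S hface
  have h1 := ρ.2.2
  rw [h, coneDim_genCone] at h1
  obtain ⟨i, rfl⟩ := Finset.card_eq_one.1 h1
  refine ⟨i, by simpa using hT, h, isRayGenerator_unique b i ?_⟩
  rw [← h]
  exact rayGenerator_spec hF ρ

lemma realForm_eq_of_rays {N : Type u} [AddCommGroup N] {F : Set (Set (RealSpace N))}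
    (hF : IsUnimodularFan F) {σ : Set (RealSpace N)} (hσ : σ ∈ F) (m m' : Module.Dual ℤ N)
    (h : ∀ ρ : Ray F, ρ.1 ⊆ σ → m (rayGenerator hF ρ) = m' (rayGenerator hF ρ)) :
    ∀ v ∈ σ, realForm m v = realForm m' v := by
  obtain ⟨b, S, rfl⟩ := hF.unimodular _ hσ
  rintro _ ⟨c, -, rfl⟩
  rw [map_sum, map_sum]
  refine Finset.sum_congr rfl fun i hi => ?_
  obtain ⟨ρ, -, hsub, hgen⟩ := hF.exists_ray b hσ hi
  have := h ρ hsub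
  rw [hgen] at this
  rw [map_smul, map_smul, realForm_lat, realForm_lat, this]

/-- On a unimodular fan, integral piecewise-linear functions correspond to arbitrary integer
values at the ray generators. -/
lemma existsUnique_rayValue {N : Type u} [AddCommGroup N] {F : Set (Set (RealSpace N))}
    (hF : IsUnimodularFan F) (z : Ray F → ℤ) : ∃! f : PL F, ∀ ρ, rayValue hF f ρ = z ρ := by
  classical
  have hm : ∀ σ ∈ F, ∃ m : Module.Dual ℤ N, ∀ ρ : Ray F, ρ.1 ⊆ σ →
      m (rayGenerator hF ρ) = z ρ := by
    intro σ hσ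
    obtain ⟨b, S, rfl⟩ := hF.unimodular _ hσ
    choose r hr using fun i : S => hF.exists_ray b hσ i.2
    refine ⟨∑ i : S, z (r i) • b.coord i, fun ρ hρ => ?_⟩
    obtain ⟨i, hi, h1, h2⟩ := hF.ray_eq_of_subset b hσ ρ hρ
    have : r ⟨i, hi⟩ = ρ := Subtype.ext ((hr ⟨i, hi⟩).1.trans h1.symm)
    rw [h2, LinearMap.sum_apply, Finset.sum_eq_single ⟨i, hi⟩]
    · simp [this]
    · intro j _ hj
      have : i ≠ (j : _) := fun h => hj (Subtype.ext h.symm)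
      simp [this]
    · exact fun h => absurd (Finset.mem_univ _) h
  choose! m hm using hm
  have hcone : ∀ x : support F, ∃ σ ∈ F, (x : RealSpace N) ∈ σ := fun x => x.2
  choose s hsF hxs using hcone
  have hval : ∀ σ ∈ F, ∀ x : support F, (x : RealSpace N) ∈ σ →
      realForm (m (s x)) x = realForm (m σ) x := by
    intro σ hσ x hx
    have hint : s x ∩ σ ∈ F :=
      hF.face_mem _ (hsF x) _ (hF.inter_face _ (hsF x) _ hσ).1
    refine realForm_eq_of_rays hF hint _ _ (fun ρ hρ => ?_) _ ⟨hxs x, hx⟩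
    rw [hm _ (hsF x) ρ (hρ.trans Set.inter_subset_left),
      hm _ hσ ρ (hρ.trans Set.inter_subset_right)]
  refine ⟨⟨fun x => realForm (m (s x)) x, fun σ hσ => ⟨m σ, hval σ hσ⟩⟩, fun ρ => ?_, ?_⟩
  · have h1 := rayValue_spec hF ⟨fun x => realForm (m (s x)) x, fun σ hσ => ⟨m σ, hval σ hσ⟩⟩ ρ
    have h2 := hval ρ.1 ρ.2.1 (rayPoint hF ρ) (rayGenerator_mem hF ρ)
    have h3 : realForm (m ρ.1) (rayPoint hF ρ : RealSpace N) = (z ρ : ℝ) := by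
      rw [← hm ρ.1 ρ.2.1 ρ subset_rfl]
      exact realForm_lat _ _
    exact_mod_cast h1.trans (h2.trans h3)
  · intro g hg
    ext x
    obtain ⟨m', hm'⟩ := g.2 (s x) (hsF x)
    rw [hm' x (hxs x)]
    refine realForm_eq_of_rays hF (hsF x) _ _ (fun ρ hρ => ?_) _ (hxs x)
    have h1 := rayValue_spec hF g ρ
    rw [hm' (rayPoint hF ρ) (hρ (rayGenerator_mem hF ρ)), hg ρ] at h1
    have h2 : realForm m' (rayPoint hF ρ : RealSpace N) = (m' (rayGenerator hF ρ) : ℝ) :=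
      realForm_lat _ _
    rw [h2] at h1
    rw [hm _ (hsF x) ρ hρ]
    exact_mod_cast h1.symm

open Classical in
/-- The Courant function `δ_ρ`: the piecewise-linear function with value `1` at `u_ρ` and value
`0` at all other ray generators. -/
def courant {N : Type u} [AddCommGroup N] {F : Set (Set (RealSpace N))}
    (hF : IsUnimodularFan F) (ρ : Ray F) : PL F :=
  (existsUnique_rayValue hF (fun ρ' => if ρ' = ρ then 1 else 0)).choose

open Classical in
lemma rayValue_courant {N : Type u} [AddCommGroup N] {F : Set (Set (RealSpace N))}
    (hF : IsUnimodularFan F) (ρ ρ' : Ray F) :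
    rayValue hF (courant hF ρ) ρ' = if ρ' = ρ then 1 else 0 :=
  (existsUnique_rayValue hF (fun ρ' => if ρ' = ρ then 1 else 0)).choose_spec.1 ρ'

/-! ### Ehrhart fans -/

/-- `χ` is an Ehrhart polynomial of the unimodular fan `F`: `χ(0) = 1` and
`χ([f]) = χ([f - δ_ρ]) + χ_{Σ^ρ}([f]^ρ)` for all `f` and all rays `ρ`, where, recursively,
`χ_{Σ^ρ}` is an Ehrhart polynomial of the star fan `Σ^ρ`. The recursion stops because the rank of
the lattice drops and a zero-dimensional fan has no rays. -/
inductive IsEhrhartPolynomial : ∀ {N : Type u} [AddCommGroup N] (F : Set (Set (RealSpace N))),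
    (UPL F → ℤ) → Prop
  | intro {N : Type u} [AddCommGroup N] (F : Set (Set (RealSpace N))) (hF : IsUnimodularFan F)
      (χ : UPL F → ℤ) (χstar : ∀ ρ : Ray F, UPL (starFan F ρ.1) → ℤ)
      (star : ∀ ρ : Ray F, IsEhrhartPolynomial (starFan F ρ.1) (χstar ρ))
      (zero : χ 0 = 1)
      (recursion : ∀ (f : PL F) (ρ : Ray F),
        χ (cls f) = χ (cls (f - courant hF ρ)) +
          χstar ρ (starClass hF.toIsRationalFan ρ.2.1 (cls f))) :
      IsEhrhartPolynomial F χ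

/-- A fan is Ehrhart if it is unimodular, all its star fans along rays are Ehrhart, and it has an
Ehrhart polynomial. -/
def IsEhrhart {N : Type u} [AddCommGroup N] (F : Set (Set (RealSpace N))) : Prop :=
  ∃ χ : UPL F → ℤ, IsEhrhartPolynomial F χ

/-! ### The Chow ring, the degree map and the volume polynomial -/

/-- The ideal generated by the products `x_{ρ_1} ⋯ x_{ρ_k}` over rays that do not lie on a common
cone. -/
def stanleyReisnerIdeal {N : Type u} [AddCommGroup N] (F : Set (Set (RealSpace N))) :
    Ideal (MvPolynomial (Ray F) ℤ) :=
  Ideal.span {p | ∃ T : Finset (Ray F), (¬ ∃ σ ∈ F, ∀ ρ ∈ T, ρ.1 ⊆ σ) ∧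
    p = ∏ ρ ∈ T, MvPolynomial.X ρ}

/-- The linear form `∑_ρ z_ρ x_ρ` (a finite sum, since a fan has finitely many rays). -/
def linearPoly {N : Type u} [AddCommGroup N] {F : Set (Set (RealSpace N))} (z : Ray F → ℤ) :
    MvPolynomial (Ray F) ℤ :=
  ∑ᶠ ρ : Ray F, MvPolynomial.C (z ρ) * MvPolynomial.X ρ

/-- The ideal generated by the linear forms `∑_ρ m(u_ρ) x_ρ`, `m ∈ M`. -/
def linearIdeal {N : Type u} [AddCommGroup N] {F : Set (Set (RealSpace N))}
    (hF : IsUnimodularFan F) : Ideal (MvPolynomial (Ray F) ℤ) :=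
  Ideal.span (Set.range fun m : Module.Dual ℤ N =>
    linearPoly fun ρ : Ray F => m (rayGenerator hF ρ))

/-- The Chow ring of a unimodular fan. -/
abbrev ChowRing {N : Type u} [AddCommGroup N] {F : Set (Set (RealSpace N))}
    (hF : IsUnimodularFan F) : Type u :=
  MvPolynomial (Ray F) ℤ ⧸ (stanleyReisnerIdeal F ⊔ linearIdeal hF)

/-- The class of a polynomial in the Chow ring. -/
abbrev chowMk {N : Type u} [AddCommGroup N] {F : Set (Set (RealSpace N))}
    (hF : IsUnimodularFan F) : MvPolynomial (Ray F) ℤ →+* ChowRing hF :=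
  Ideal.Quotient.mk (stanleyReisnerIdeal F ⊔ linearIdeal hF)

/-- The degree `k` piece of the Chow ring: the classes of homogeneous polynomials of degree `k`. -/
def chowPiece {N : Type u} [AddCommGroup N] {F : Set (Set (RealSpace N))}
    (hF : IsUnimodularFan F) (k : ℕ) : AddSubgroup (ChowRing hF) :=
  (MvPolynomial.homogeneousSubmodule (Ray F) ℤ k).toAddSubgroup.map (chowMk hF).toAddMonoidHom

lemma chowMk_mem {N : Type u} [AddCommGroup N] {F : Set (Set (RealSpace N))}
    (hF : IsUnimodularFan F) {k : ℕ} {p : MvPolynomial (Ray F) ℤ} (hp : p.IsHomogeneous k) :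
    chowMk hF p ∈ chowPiece hF k :=
  ⟨p, hp, rfl⟩

lemma isHomogeneous_prod_X {N : Type u} [AddCommGroup N] {F : Set (Set (RealSpace N))}
    (T : Finset (Ray F)) :
    (∏ ρ ∈ T, (MvPolynomial.X ρ : MvPolynomial (Ray F) ℤ)).IsHomogeneous T.card := by
  have := MvPolynomial.IsHomogeneous.prod T (fun ρ => (MvPolynomial.X ρ : MvPolynomial (Ray F) ℤ))
    (fun _ => 1) (fun ρ _ => MvPolynomial.isHomogeneous_X ℤ ρ)
  simpa using this

/-- `deg` is the degree map on the degree `d` piece of the Chow ring of a `d`-dimensional fan: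
`deg(x_{ρ_1} ⋯ x_{ρ_d}) = 1` whenever `ρ_1, …, ρ_d` are the rays of a `d`-dimensional cone. -/
def IsDegreeMap {N : Type u} [AddCommGroup N] {F : Set (Set (RealSpace N))}
    (hF : IsUnimodularFan F) (d : ℕ) (deg : chowPiece hF d →+ ℤ) : Prop :=
  ∀ σ ∈ F, coneDim σ = d → ∀ T : Finset (Ray F), (∀ ρ : Ray F, ρ ∈ T ↔ ρ.1 ⊆ σ) →
    ∀ hT : T.card = d,
      deg ⟨chowMk hF (∏ ρ ∈ T, MvPolynomial.X ρ), chowMk_mem hF (hT ▸ isHomogeneous_prod_X T)⟩ = 1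

lemma IsRationalFan.finite_ray {N : Type u} [AddCommGroup N] {F : Set (Set (RealSpace N))}
    (hF : IsRationalFan F) : Finite (Ray F) :=
  (hF.finite.subset fun _ h => h.1 : {ρ | ρ ∈ F ∧ coneDim ρ = 1}.Finite).to_subtype

lemma linearPoly_add {N : Type u} [AddCommGroup N] {F : Set (Set (RealSpace N))}
    (hF : IsRationalFan F) (z w : Ray F → ℤ) :
    linearPoly (z + w) = linearPoly z + linearPoly w := by
  have := hF.finite_ray
  rw [linearPoly, linearPoly, linearPoly,
    ← finsum_add_distrib (Set.toFinite _) (Set.toFinite _)]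
  simp [add_mul]

lemma linearPoly_isHomogeneous {N : Type u} [AddCommGroup N] {F : Set (Set (RealSpace N))}
    (z : Ray F → ℤ) : (linearPoly z).IsHomogeneous 1 := by
  rw [← MvPolynomial.mem_homogeneousSubmodule]
  refine finsum_induction (fun p => p ∈ MvPolynomial.homogeneousSubmodule (Ray F) ℤ 1)
    (Submodule.zero_mem _) (fun _ _ => Submodule.add_mem _) fun ρ => ?_
  exact (MvPolynomial.isHomogeneous_C_mul_X _ _)

lemma rayValue_add {N : Type u} [AddCommGroup N] {F : Set (Set (RealSpace N))}
    (hF : IsUnimodularFan F) (f g : PL F) :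
    rayValue hF (f + g) = rayValue hF f + rayValue hF g := by
  funext ρ
  have : (rayValue hF (f + g) ρ : ℝ) = rayValue hF f ρ + rayValue hF g ρ := by
    rw [rayValue_spec, rayValue_spec, rayValue_spec]; rfl
  exact_mod_cast this

lemma rayValue_restrictLinear {N : Type u} [AddCommGroup N] {F : Set (Set (RealSpace N))}
    (hF : IsUnimodularFan F) (m : Module.Dual ℤ N) (ρ : Ray F) :
    rayValue hF (restrictLinear F m) ρ = m (rayGenerator hF ρ) := by
  have := rayValue_spec hF (restrictLinear F m) ρ
  have h2 : (restrictLinear F m).1 (rayPoint hF ρ) = (m (rayGenerator hF ρ) : ℝ) :=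
    realForm_lat _ _
  exact_mod_cast this.trans h2

/-- The identification of piecewise-linear functions up to translation with the degree one part of
the Chow ring, `[f] ↦ ∑_ρ f(u_ρ) x_ρ`. -/
def toChow {N : Type u} [AddCommGroup N] {F : Set (Set (RealSpace N))}
    (hF : IsUnimodularFan F) : UPL F →+ ChowRing hF :=
  QuotientAddGroup.lift (linearFunctions F)
    (AddMonoidHom.mk' (fun f => chowMk hF (linearPoly (rayValue hF f))) fun f g => by
      rw [rayValue_add, linearPoly_add hF.toIsRationalFan, map_add])
    (by
      rintro _ ⟨m, rfl⟩
      refine Ideal.Quotient.eq_zero_iff_mem.2 (Ideal.mem_sup_right (Ideal.subset_span ⟨m, ?_⟩))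
      exact congrArg linearPoly (funext fun ρ => (rayValue_restrictLinear hF m ρ).symm))

lemma toChow_pow_mem {N : Type u} [AddCommGroup N] {F : Set (Set (RealSpace N))}
    (hF : IsUnimodularFan F) (q : UPL F) (k : ℕ) : toChow hF q ^ k ∈ chowPiece hF k := by
  obtain ⟨f, rfl⟩ := QuotientAddGroup.mk_surjective q
  change chowMk hF (linearPoly (rayValue hF f)) ^ k ∈ _
  rw [← map_pow]
  have := (linearPoly_isHomogeneous (rayValue hF f)).pow k
  rw [one_mul] at this
  exact chowMk_mem hF this

/-- The volume polynomial `[f] ↦ deg([f]^d)`. -/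
def volumePolynomial {N : Type u} [AddCommGroup N] {F : Set (Set (RealSpace N))}
    (hF : IsUnimodularFan F) (d : ℕ) (deg : chowPiece hF d →+ ℤ) (q : UPL F) : ℤ :=
  deg ⟨toChow hF q ^ d, toChow_pow_mem hF q d⟩

/-- The polynomial `P` in variables `x_ρ` represents the function `χ` on piecewise-linear
functions up to translation: `χ([f])` is obtained by evaluating `x_ρ` at `f(u_ρ)`. -/
def Represents {N : Type u} [AddCommGroup N] {F : Set (Set (RealSpace N))}
    (hF : IsUnimodularFan F) (P : MvPolynomial (Ray F) ℚ) (χ : UPL F → ℚ) : Prop :=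
  ∀ f : PL F, MvPolynomial.eval (fun ρ => (rayValue hF f ρ : ℚ)) P = χ (cls f)

end

end EhrhartFan

namespace EhrhartFan

/-! ### Rays of star fans -/

section StarRays

variable {N : Type u} [AddCommGroup N] {F : Set (Set (RealSpace N))}

/-! Let `G` be the group of classes [f]. Extend χ additively to the group ring ℤ[G], with
augmentation ideal I. The recursion then says that multiplication by 1 - [-δ_ρ] turns χ into the
Ehrhart polynomial of the star fan, composed with the pushforward along [f] ↦ [f]^ρ
(`extendFun_mul_diffElt_courant`). Induction over star fans gives three facts. A product of these
differences over rays on no common cone, times anything, has value 0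
(`IsEhrhartPolynomial.extendFun_mul_prod_eq_zero`). A product over distinct rays of one cone has
value 1 (`IsEhrhartPolynomial.extendFun_prod_eq_one`). Since the differences generate I, χ kills
I^(d+1) (`IsEhrhartPolynomial.extendFun_eq_zero`).

The degree map is x_ρ ↦ 1 - [-δ_ρ] on forms of degree d, followed by χ. It kills the Stanley-Reisner
part by the first fact. As g ↦ [g] - 1 is additive modulo I², the linear relations go into I², so
their multiples of degree d go into I^(d+1), where χ vanishes. The second fact is the normalization.
Uniqueness holds because squarefree cone monomials generate A^d (`chowMk_monomial_mem_closure`).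

Modulo I^(d+1), [z g] is the truncated binomial series of (1 + ([g] - 1))^z (`mk_single_zsmul`).
Hence χ is a polynomial of degree at most d in the values f(u_ρ). Along t ↦ t f its coefficient of
t^d is χ(([f] - 1)^d)/d!, and χ(([f] - 1)^d) = deg([f]^d), because the linear form of f is sent to
[f] - 1 modulo I². The degree is no smaller, since the iterated difference along the rays of a
d-dimensional cone is 1. -/

lemma starProj_lat (σ : Set (RealSpace N)) (n : N) :
    starProj σ (lat n) = lat ((coneLattice σ).mkQ n) := by
  simp [starProj, lat]

lemma lat_zero : lat (0 : N) = 0 := by simp [lat]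

lemma IsRationalFan.isFace_of_subset (hF : IsRationalFan F) {τ σ : Set (RealSpace N)}
    (hτ : τ ∈ F) (hσ : σ ∈ F) (h : τ ⊆ σ) : IsFace τ σ := by
  have := (hF.inter_face τ hτ σ hσ).2
  rwa [Set.inter_eq_left.2 h] at this

lemma mem_ray_iff (hF : IsUnimodularFan F) (ρ : Ray F) (v : RealSpace N) :
    v ∈ ρ.1 ↔ ∃ c : ℝ, 0 ≤ c ∧ v = c • lat (rayGenerator hF ρ) := by
  obtain ⟨b, i, h⟩ := hF.ray_eq ρ
  have hu : rayGenerator hF ρ = b i :=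
    isRayGenerator_unique b i (h ▸ rayGenerator_spec hF ρ)
  rw [h, hu]
  constructor
  · rintro ⟨c, hc, rfl⟩
    exact ⟨c i, hc i, by simp⟩
  · rintro ⟨c, hc, rfl⟩
    exact ⟨fun _ => c, fun _ => hc, by simp⟩

lemma ray_subset_iff (hF : IsUnimodularFan F) (ρ : Ray F) {σ : Set (RealSpace N)} (hσ : σ ∈ F) :
    ρ.1 ⊆ σ ↔ lat (rayGenerator hF ρ) ∈ σ := by
  refine ⟨fun h => h (rayGenerator_mem hF ρ), fun h v hv => ?_⟩
  obtain ⟨c, hc, rfl⟩ := (mem_ray_iff hF ρ v).1 hv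
  exact (hF.rational σ hσ).smul_mem h hc

lemma PL_ext (hF : IsUnimodularFan F) {f g : PL F}
    (h : ∀ ρ, rayValue hF f ρ = rayValue hF g ρ) : f = g :=
  (existsUnique_rayValue hF (rayValue hF g)).unique h fun _ => rfl

lemma rayValue_eq_dual (hF : IsUnimodularFan F) {f : PL F} {σ : Set (RealSpace N)}
    {m : Module.Dual ℤ N}
    (hm : ∀ x : support F, (x : RealSpace N) ∈ σ → f.1 x = realForm m x) (ρ : Ray F)
    (hρ : ρ.1 ⊆ σ) : rayValue hF f ρ = m (rayGenerator hF ρ) := by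
  have h1 := rayValue_spec hF f ρ
  rw [hm (rayPoint hF ρ) (hρ (rayGenerator_mem hF ρ))] at h1
  exact_mod_cast h1.trans (realForm_lat m _)

lemma exists_dual_eq (hF : IsUnimodularFan F) {σ : Set (RealSpace N)} (hσ : σ ∈ F)
    (z : Ray F → ℤ) : ∃ m : Module.Dual ℤ N, ∀ ρ : Ray F, ρ.1 ⊆ σ →
      m (rayGenerator hF ρ) = z ρ := by
  obtain ⟨f, hf, -⟩ := existsUnique_rayValue hF z
  obtain ⟨m, hm⟩ := f.2 σ hσ
  exact ⟨m, fun ρ hρ => by rw [← hf ρ, rayValue_eq_dual hF hm ρ hρ]⟩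

lemma mem_vanishingOn_ray (hF : IsUnimodularFan F) {g : PL F} {ρ : Ray F}
    (h : rayValue hF g ρ = 0) : g ∈ vanishingOn F ρ.1 := by
  intro x hx
  obtain ⟨m, hm⟩ := g.2 ρ.1 ρ.2.1
  have h0 := rayValue_eq_dual hF hm ρ subset_rfl
  obtain ⟨c, -, hc⟩ := (mem_ray_iff hF ρ x).1 hx
  rw [hm x hx, hc, map_smul, realForm_lat, ← h0, h]
  simp

lemma coneLattice_ray_le_ker (hF : IsUnimodularFan F) {ρ : Ray F} {m : Module.Dual ℤ N}
    (h : m (rayGenerator hF ρ) = 0) : coneLattice ρ.1 ≤ LinearMap.ker m :=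
  coneLattice_le_ker fun v hv => by
    obtain ⟨c, -, rfl⟩ := (mem_ray_iff hF ρ v).1 hv
    rw [map_smul, realForm_lat, h]
    simp

/-- Two distinct rays that lie on a common cone. -/
def Adjacent (ρ ρ' : Ray F) : Prop := ρ' ≠ ρ ∧ ∃ σ ∈ F, ρ.1 ⊆ σ ∧ ρ'.1 ⊆ σ

lemma Adjacent.mem_neighborhood (hF : IsUnimodularFan F) {ρ ρ' : Ray F} (h : Adjacent ρ ρ') :
    ρ'.1 ∈ neighborhood F ρ.1 := by
  obtain ⟨-, σ, hσ, h1, h2⟩ := h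
  exact ⟨ρ'.2.1, σ, hσ, hF.isFace_of_subset ρ.2.1 hσ h1, hF.isFace_of_subset ρ'.2.1 hσ h2⟩

lemma Adjacent.exists_dual (hF : IsUnimodularFan F) {ρ ρ' : Ray F} (h : Adjacent ρ ρ') :
    ∃ m : Module.Dual ℤ N, m (rayGenerator hF ρ) = 0 ∧ m (rayGenerator hF ρ') = 1 := by
  classical
  obtain ⟨hne, σ, hσ, h1, h2⟩ := h
  obtain ⟨m, hm⟩ := exists_dual_eq hF hσ (fun κ => if κ = ρ' then 1 else 0)
  exact ⟨m, by rw [hm _ h1, if_neg hne.symm], by rw [hm _ h2, if_pos rfl]⟩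

lemma mem_starProj_image_iff (hF : IsUnimodularFan F) (σ : Set (RealSpace N)) (ρ : Ray F)
    (v : RealSpace (StarLattice σ)) : v ∈ starProj σ '' ρ.1 ↔
      ∃ c : ℝ, 0 ≤ c ∧ v = c • lat ((coneLattice σ).mkQ (rayGenerator hF ρ)) := by
  constructor
  · rintro ⟨x, hx, rfl⟩
    obtain ⟨c, hc, rfl⟩ := (mem_ray_iff hF ρ x).1 hx
    exact ⟨c, hc, by rw [map_smul, starProj_lat]⟩
  · rintro ⟨c, hc, rfl⟩
    exact ⟨c • lat (rayGenerator hF ρ), (mem_ray_iff hF ρ _).2 ⟨c, hc, rfl⟩, by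
      rw [map_smul, starProj_lat]⟩

/-- Only the dimension needs an argument: a dual vector that is 0 on u_ρ and 1 on u_ρ' descends to
the quotient lattice, so the image of u_ρ' is nonzero. -/
lemma Adjacent.exists_linkRay (hF : IsUnimodularFan F) {ρ ρ' : Ray F}
    (h : Adjacent ρ ρ') : ∃ κ : Ray (starFan F ρ.1), κ.1 = starProj ρ.1 '' ρ'.1 := by
  obtain ⟨m, hm0, hm1⟩ := h.exists_dual hF
  have hker := coneLattice_ray_le_ker hF hm0
  refine ⟨⟨starProj ρ.1 '' ρ'.1, ⟨ρ'.1, h.mem_neighborhood hF, rfl⟩, ?_⟩, rfl⟩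
  have hspan : Submodule.span ℝ (starProj ρ.1 '' ρ'.1) =
      Submodule.span ℝ {lat ((coneLattice ρ.1).mkQ (rayGenerator hF ρ'))} := by
    apply le_antisymm <;> rw [Submodule.span_le]
    · intro v hv
      obtain ⟨c, -, rfl⟩ := (mem_starProj_image_iff hF _ _ _).1 hv
      exact Submodule.smul_mem _ _ (Submodule.mem_span_singleton_self _)
    · rw [Set.singleton_subset_iff]
      exact Submodule.subset_span
        ((mem_starProj_image_iff hF _ _ _).2 ⟨1, zero_le_one, (one_smul _ _).symm⟩)
  rw [coneDim, hspan]
  refine finrank_span_singleton fun h0 => ?_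
  have h1 := realForm_lat ((coneLattice ρ.1).liftQ m hker)
    ((coneLattice ρ.1).mkQ (rayGenerator hF ρ'))
  rw [h0, map_zero] at h1
  simp [hm1] at h1

/-- The ray of the star fan at `ρ` that is the image of an adjacent ray. -/
noncomputable def linkRay (hF : IsUnimodularFan F) {ρ ρ' : Ray F} (h : Adjacent ρ ρ') :
    Ray (starFan F ρ.1) :=
  (h.exists_linkRay hF).choose

lemma linkRay_val (hF : IsUnimodularFan F) {ρ ρ' : Ray F} (h : Adjacent ρ ρ') :
    (linkRay hF h).1 = starProj ρ.1 '' ρ'.1 :=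
  (h.exists_linkRay hF).choose_spec

lemma rayGenerator_linkRay (hF : IsUnimodularFan F) {ρ ρ' : Ray F} (h : Adjacent ρ ρ')
    (hS : IsUnimodularFan (starFan F ρ.1)) :
    rayGenerator hS (linkRay hF h) = (coneLattice ρ.1).mkQ (rayGenerator hF ρ') := by
  obtain ⟨m, hm0, hm1⟩ := h.exists_dual hF
  have hker := coneLattice_ray_le_ker hF hm0
  have hmem : (coneLattice ρ.1).mkQ (rayGenerator hF ρ') ∈
      {n | lat n ∈ (linkRay hF h).1} := by
    rw [Set.mem_ofPred_eq, linkRay_val, ← starProj_lat]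
    exact ⟨_, rayGenerator_mem hF ρ', rfl⟩
  rw [← rayGenerator_spec hS] at hmem
  obtain ⟨k, hk⟩ := AddSubmonoid.mem_closure_singleton.1 hmem
  -- The image of u_ρ' is k times the generator. A form with value 1 on it forces k to divide 1, so
  -- the image is itself primitive.
  have h1 := congrArg ((coneLattice ρ.1).liftQ m hker) hk
  rw [map_nsmul, Submodule.mkQ_apply, Submodule.liftQ_apply, hm1, nsmul_eq_mul] at h1
  have hk1 : k = 1 := by
    have := Int.eq_one_or_neg_one_of_mul_eq_one h1
    omega
  rw [← hk, hk1, one_nsmul]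

/-- The cone τ that projects onto κ need not be a ray, for it may contain ρ. But any generator of τ
other than u_ρ has nonzero image in κ and therefore spans it. -/
lemma exists_linkRay_eq (hF : IsUnimodularFan F) {ρ : Ray F}
    (hS : IsUnimodularFan (starFan F ρ.1)) (κ : Ray (starFan F ρ.1)) :
    ∃ (ρ' : Ray F) (h : Adjacent ρ ρ'), linkRay hF h = κ := by
  classical
  obtain ⟨τ, ⟨hτ, σ, hσ, hρσ, hτσ⟩, hτκ⟩ := κ.2.1
  replace hτκ : starProj ρ.1 '' τ = κ.1 := hτκ
  obtain ⟨b, S, rfl⟩ := hF.unimodular _ hσ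
  obtain ⟨T, hTS, rfl⟩ := genCone_eq_of_isFace b S hτσ
  obtain ⟨i, hi, hρi, hui⟩ := hF.ray_eq_of_subset b hσ ρ hρσ.subset
  have hne0 : lat (rayGenerator hS κ) ≠ 0 := by
    intro h0
    have hd := κ.2.2
    have : Submodule.span ℝ κ.1 = ⊥ := by
      rw [Submodule.span_eq_bot]
      intro v hv
      obtain ⟨c, -, rfl⟩ := (mem_ray_iff hS κ v).1 hv
      rw [h0, smul_zero]
    rw [coneDim, this, finrank_bot] at hd
    exact zero_ne_one hd
  -- If u_ρ were the only possible generator of τ, the projection of τ would be zero.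
  have hex : ∃ j ∈ T, j ≠ i := by
    by_contra! hall
    have hmem := rayGenerator_mem hS κ
    rw [← hτκ] at hmem
    obtain ⟨_, ⟨c, -, rfl⟩, hx⟩ := hmem
    refine hne0 (hx.symm.trans ?_)
    rw [map_sum]
    refine Finset.sum_eq_zero fun j hj => ?_
    rw [hall j hj, map_smul, starProj_lat]
    have : (coneLattice ρ.1).mkQ (b i) = 0 := by
      rw [Submodule.mkQ_apply, Submodule.Quotient.mk_eq_zero, ← hui]
      exact Submodule.subset_span (rayGenerator_mem hF ρ)
    rw [this, lat_zero, smul_zero]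
  obtain ⟨j, hjT, hji⟩ := hex
  obtain ⟨ρ', hρ'j, hρ'S, huj⟩ := hF.exists_ray b hσ (hTS hjT)
  have hadj : Adjacent ρ ρ' := by
    refine ⟨?_, _, hσ, hρσ.subset, hρ'S⟩
    rintro rfl
    exact hji (b.injective (huj.symm.trans hui))
  refine ⟨ρ', hadj, Subtype.ext ?_⟩
  have hmem : lat ((coneLattice ρ.1).mkQ (rayGenerator hF ρ')) ∈ κ.1 := by
    rw [← hτκ, ← starProj_lat, huj]
    exact ⟨_, lat_mem_genCone b hjT, rfl⟩
  obtain ⟨a, ha, hau⟩ := (mem_ray_iff hS κ _).1 hmem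
  have ha0 : a ≠ 0 := by
    rintro rfl
    obtain ⟨m, hm0, hm1⟩ := hadj.exists_dual hF
    have h1 := realForm_lat ((coneLattice ρ.1).liftQ m (coneLattice_ray_le_ker hF hm0))
      ((coneLattice ρ.1).mkQ (rayGenerator hF ρ'))
    rw [hau, zero_smul, map_zero] at h1
    simp [hm1] at h1
  ext v
  rw [linkRay_val, mem_starProj_image_iff hF, mem_ray_iff hS, hau]
  constructor
  · rintro ⟨c, hc, rfl⟩
    exact ⟨c * a, mul_nonneg hc ha, by rw [smul_smul]⟩
  · rintro ⟨c, hc, rfl⟩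
    exact ⟨c / a, div_nonneg hc ha, by rw [smul_smul, div_mul_cancel₀ _ ha0]⟩

/-! ### Courant functions, cones and dimensions under passage to the star fan -/

lemma rayValue_descend (hF : IsUnimodularFan F) {ρ ρ' : Ray F}
    (hS : IsUnimodularFan (starFan F ρ.1)) (h : Adjacent ρ ρ') (g : vanishingOn F ρ.1) :
    rayValue hS (descend hF.toIsRationalFan ρ.2.1 g) (linkRay hF h) = rayValue hF g.1 ρ' := by
  have h1 := rayValue_spec hS (descend hF.toIsRationalFan ρ.2.1 g) (linkRay hF h)
  have h2 : (descend hF.toIsRationalFan ρ.2.1 g).1 (rayPoint hS (linkRay hF h)) =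
      g.1.1 (rayPoint hF ρ') :=
    descendFun_apply hF.toIsRationalFan ρ.2.1 g.2 _ (rayPoint hF ρ') (h.mem_neighborhood hF)
      (rayGenerator_mem hF ρ') (by
        change starProj ρ.1 (lat (rayGenerator hF ρ')) = lat (rayGenerator hS (linkRay hF h))
        rw [rayGenerator_linkRay, starProj_lat])
  rw [h2, ← rayValue_spec] at h1
  exact_mod_cast h1

lemma courant_mem_vanishingOn (hF : IsUnimodularFan F) {ρ ρ' : Ray F} (h : ρ' ≠ ρ) :
    courant hF ρ' ∈ vanishingOn F ρ.1 :=
  mem_vanishingOn_ray hF (by rw [rayValue_courant, if_neg h.symm])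

/-- The Courant function of ρ₁ vanishes on ρ, so it descends to the star fan and separates the image
of ρ₁ from the images of the other adjacent rays. -/
lemma linkRay_injective (hF : IsUnimodularFan F) {ρ ρ₁ ρ₂ : Ray F}
    (hS : IsUnimodularFan (starFan F ρ.1)) (h₁ : Adjacent ρ ρ₁) (h₂ : Adjacent ρ ρ₂)
    (h : linkRay hF h₁ = linkRay hF h₂) : ρ₁ = ρ₂ := by
  have e₁ := rayValue_descend hF hS h₁ ⟨_, courant_mem_vanishingOn hF h₁.1⟩
  have e₂ := rayValue_descend hF hS h₂ ⟨_, courant_mem_vanishingOn hF h₁.1⟩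
  rw [h, e₂] at e₁
  simp only [rayValue_courant, if_true] at e₁
  by_contra hne
  rw [if_neg (Ne.symm hne)] at e₁
  exact zero_ne_one e₁

lemma starClass_eq_cls_descend (hF : IsRationalFan F) {σ : Set (RealSpace N)} (hσ : σ ∈ F)
    (g : vanishingOn F σ) : starClass hF hσ (cls g.1) = cls (descend hF hσ g) := by
  rw [starClass_cls hF hσ g.1 0 (by simp)]
  congr 2
  simp

lemma starClass_courant_of_adjacent (hF : IsUnimodularFan F) {ρ ρ' : Ray F}
    (hS : IsUnimodularFan (starFan F ρ.1)) (h : Adjacent ρ ρ') :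
    starClass hF.toIsRationalFan ρ.2.1 (cls (courant hF ρ')) =
      cls (courant hS (linkRay hF h)) := by
  rw [starClass_eq_cls_descend hF.toIsRationalFan ρ.2.1 ⟨_, courant_mem_vanishingOn hF h.1⟩]
  refine congrArg cls (PL_ext hS fun κ => ?_)
  obtain ⟨ρ'', h', rfl⟩ := exists_linkRay_eq hF hS κ
  rw [rayValue_descend hF hS h', rayValue_courant, rayValue_courant]
  refine if_congr ⟨?_, linkRay_injective hF hS h' h⟩ rfl rfl
  rintro rfl
  rfl

/-- Every ray of the star fan comes from a ray adjacent to ρ, and δ_ρ' is 0 on all of those. -/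
lemma starClass_courant_of_not_adjacent (hF : IsUnimodularFan F) {ρ ρ' : Ray F}
    (hS : IsUnimodularFan (starFan F ρ.1)) (hne : ρ' ≠ ρ) (h : ¬ Adjacent ρ ρ') :
    starClass hF.toIsRationalFan ρ.2.1 (cls (courant hF ρ')) = 0 := by
  rw [starClass_eq_cls_descend hF.toIsRationalFan ρ.2.1 ⟨_, courant_mem_vanishingOn hF hne⟩,
    ← map_zero cls]
  refine congrArg cls (PL_ext hS fun κ => ?_)
  obtain ⟨ρ'', h', rfl⟩ := exists_linkRay_eq hF hS κ
  rw [rayValue_descend hF hS h', rayValue_courant, if_neg]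
  · have h0 := rayValue_spec hS 0 (linkRay hF h')
    rw [show (0 : PL (starFan F ρ.1)).1 (rayPoint hS (linkRay hF h')) = 0 from rfl] at h0
    exact_mod_cast h0.symm
  · rintro rfl
    exact h h'

/-- This lifts a cone of the star fan back to Σ, so that non-faces pass to non-faces. The value of
δ_ρ' depends only on the projection, so it is 1 at some point x of σ; if ρ' were not in σ, then δ_ρ'
would vanish on σ. -/
lemma exists_cone_of_linkRay_subset (hF : IsUnimodularFan F) {ρ : Ray F}
    {κ : Set (RealSpace (StarLattice ρ.1))} (hκ : κ ∈ starFan F ρ.1) :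
    ∃ σ ∈ F, ρ.1 ⊆ σ ∧ ∀ (ρ' : Ray F) (h : Adjacent ρ ρ'), (linkRay hF h).1 ⊆ κ → ρ'.1 ⊆ σ := by
  classical
  obtain ⟨τ, hτ, rfl⟩ := hκ
  obtain ⟨hτF, σ, hσ, hρσ, hτσ⟩ := id hτ
  refine ⟨σ, hσ, hρσ.subset, fun ρ' h hsub => ?_⟩
  rw [linkRay_val] at hsub
  obtain ⟨x, hx, hxu⟩ := hsub ⟨_, rayGenerator_mem hF ρ', rfl⟩
  have key := eq_of_starProj_eq hF.toIsRationalFan ρ.2.1 (courant_mem_vanishingOn hF h.1)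
    (x := ⟨x, τ, hτF, hx⟩) (y := rayPoint hF ρ') hτ (h.mem_neighborhood hF) hx
    (rayGenerator_mem hF ρ') hxu
  rw [← rayValue_spec, rayValue_courant, if_pos rfl] at key
  by_contra hnot
  obtain ⟨m, hm⟩ := (courant hF ρ').2 σ hσ
  rw [hm _ (hτσ.subset hx), realForm_eq_of_rays hF hσ m 0 (fun ρ'' h'' => ?_) x
    (hτσ.subset hx)] at key
  · simp [realForm] at key
  · rw [← rayValue_eq_dual hF hm ρ'' h'', rayValue_courant, if_neg]
    · rfl
    · rintro rfl
      exact hnot h''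

lemma starFan_mem_of_subset (hF : IsRationalFan F) {ρ : Ray F} {σ : Set (RealSpace N)}
    (hσ : σ ∈ F) (h : ρ.1 ⊆ σ) : starProj ρ.1 '' σ ∈ starFan F ρ.1 :=
  ⟨σ, ⟨hσ, σ, hσ, hF.isFace_of_subset ρ.2.1 hσ h, hF.isFace_of_subset hσ hσ subset_rfl⟩, rfl⟩

lemma finrank_span_image_le_card {V W ι : Type*} [AddCommGroup V] [Module ℝ V] [AddCommGroup W]
    [Module ℝ W] (f : V →ₗ[ℝ] W) (S : Finset ι) (v : ι → V) {A : Set V}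
    (hA : ∀ x ∈ A, ∃ c : ι → ℝ, f x = ∑ j ∈ S, c j • f (v j)) :
    Module.finrank ℝ (Submodule.span ℝ (f '' A)) ≤ S.card := by
  classical
  have hle : Submodule.span ℝ (f '' A) ≤
      Submodule.span ℝ ((S.image fun j => f (v j) : Finset W) : Set W) := by
    rw [Submodule.span_le]
    rintro _ ⟨x, hx, rfl⟩
    obtain ⟨c, hc⟩ := hA x hx
    rw [hc]
    exact Submodule.sum_mem _ fun j hj => Submodule.smul_mem _ _
      (Submodule.subset_span (Finset.mem_coe.2 (Finset.mem_image_of_mem _ hj)))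
  exact (Submodule.finrank_mono hle).trans
    ((finrank_span_finset_le_card _).trans Finset.card_image_le)

/-- The projection kills u_ρ, one of the basis vectors generating σ, so the images of the remaining
generators span. -/
lemma coneDim_starFan_le (hF : IsUnimodularFan F) {n : ℕ} (hn : ∀ σ ∈ F, coneDim σ ≤ n + 1)
    (ρ : Ray F) : ∀ κ ∈ starFan F ρ.1, coneDim κ ≤ n := by
  classical
  rintro _ ⟨τ, ⟨hτ, σ, hσ, hρσ, hτσ⟩, rfl⟩
  have hdim := hn σ hσ
  obtain ⟨b, S, rfl⟩ := hF.unimodular _ hσ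
  obtain ⟨i, hi, hρi, hui⟩ := hF.ray_eq_of_subset b hσ ρ hρσ.subset
  rw [coneDim_genCone] at hdim
  have hcard := Finset.card_erase_of_mem hi
  refine (finrank_span_image_le_card (starProj ρ.1) (S.erase i) (fun j => lat (b j)) ?_).trans
    (by omega)
  intro x hx
  obtain ⟨c, -, rfl⟩ := hτσ.subset hx
  refine ⟨c, ?_⟩
  have h0 : starProj ρ.1 (c i • lat (b i)) = 0 := by
    have : (coneLattice ρ.1).mkQ (b i) = 0 := by
      rw [Submodule.mkQ_apply, Submodule.Quotient.mk_eq_zero, ← hui]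
      exact Submodule.subset_span (rayGenerator_mem hF ρ)
    rw [map_smul, starProj_lat, this, lat_zero, smul_zero]
  rw [map_sum, ← Finset.add_sum_erase S _ hi, h0, zero_add]
  exact Finset.sum_congr rfl fun j _ => map_smul _ _ _

end StarRays

/-! ### Difference operators as elements of a group ring -/

section GroupRing

variable {G H : Type*} [AddCommGroup G] [AddCommGroup H]

/-- The element `1 - [-g]` of the group ring, which acts on functions as the backward difference
operator in the direction `g`. -/
noncomputable def diffElt (g : G) : AddMonoidAlgebra ℤ G := 1 - AddMonoidAlgebra.single (-g) 1

/-- The augmentation ideal of the group ring. -/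
noncomputable def augIdeal (G : Type*) [AddCommGroup G] : Ideal (AddMonoidAlgebra ℤ G) :=
  Ideal.span (Set.range fun g : G => AddMonoidAlgebra.single g 1 - 1)

/-- The additive extension of a function on a group to its group ring. -/
noncomputable def extendFun {G : Type*} (χ : G → ℤ) : AddMonoidAlgebra ℤ G →ₗ[ℤ] ℤ :=
  (Finsupp.linearCombination ℤ χ).comp
    (AddMonoidAlgebra.coeffLinearEquiv ℤ : AddMonoidAlgebra ℤ G ≃ₗ[ℤ] G →₀ ℤ).toLinearMap

lemma extendFun_single {G : Type*} (χ : G → ℤ) (g : G) (a : ℤ) :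
    extendFun χ (AddMonoidAlgebra.single g a) = a * χ g := by
  simp [extendFun, AddMonoidAlgebra.coeffLinearEquiv]

lemma extendFun_one (χ : G → ℤ) : extendFun χ 1 = χ 0 := by
  rw [AddMonoidAlgebra.one_def, extendFun_single, one_mul]

lemma single_sub_one_mem_augIdeal (g : G) :
    AddMonoidAlgebra.single g 1 - 1 ∈ augIdeal G :=
  Ideal.subset_span ⟨g, rfl⟩

lemma diffElt_mem_augIdeal (g : G) : diffElt g ∈ augIdeal G := by
  rw [diffElt, ← neg_sub]
  exact neg_mem (single_sub_one_mem_augIdeal _)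

lemma diffElt_zero : diffElt (0 : G) = 0 := by
  rw [diffElt, neg_zero, AddMonoidAlgebra.one_def, sub_self]

lemma map_diffElt (s : G →+ H) (g : G) :
    AddMonoidAlgebra.mapDomainRingHom ℤ s (diffElt g) = diffElt (s g) := by
  rw [diffElt, map_sub, map_one, diffElt, AddMonoidAlgebra.mapDomainRingHom_apply,
    AddMonoidAlgebra.mapDomain_single, map_neg]

lemma map_augIdeal_le (s : G →+ H) :
    (augIdeal G).map (AddMonoidAlgebra.mapDomainRingHom ℤ s) ≤ augIdeal H := by
  rw [augIdeal, Ideal.map_span, Ideal.span_le]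
  rintro _ ⟨_, ⟨g, rfl⟩, rfl⟩
  dsimp only
  rw [map_sub, map_one, AddMonoidAlgebra.mapDomainRingHom_apply,
    AddMonoidAlgebra.mapDomain_single]
  exact single_sub_one_mem_augIdeal _

lemma map_mem_augIdeal_pow (s : G →+ H) {n : ℕ} {r : AddMonoidAlgebra ℤ G}
    (hr : r ∈ augIdeal G ^ n) :
    AddMonoidAlgebra.mapDomainRingHom ℤ s r ∈ augIdeal H ^ n := by
  have := Ideal.mem_map_of_mem (AddMonoidAlgebra.mapDomainRingHom ℤ s) hr
  rw [Ideal.map_pow] at this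
  exact Ideal.pow_right_mono (map_augIdeal_le s) n this

/-- By additivity it is enough to test group elements, where this is the recursion itself. In this
form the recursion can be iterated by multiplying ring elements. -/
lemma extendFun_mul_diffElt {χ : G → ℤ} {ψ : H → ℤ} {s : G →+ H} {a : G}
    (h : ∀ g, χ g = χ (g - a) + ψ (s g)) (r : AddMonoidAlgebra ℤ G) :
    extendFun χ (r * diffElt a) =
      extendFun ψ (AddMonoidAlgebra.mapDomainRingHom ℤ s r) := by
  induction r using AddMonoidAlgebra.induction_linear with
  | zero => simp
  | add x y hx hy => rw [add_mul, map_add, map_add, map_add, hx, hy]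
  | single g c =>
    rw [diffElt, mul_sub, mul_one, AddMonoidAlgebra.single_mul_single, map_sub,
      AddMonoidAlgebra.mapDomainRingHom_apply, AddMonoidAlgebra.mapDomain_single,
      extendFun_single, extendFun_single, extendFun_single, mul_one, ← sub_eq_add_neg, h g]
    linarith [mul_add c (χ (g - a)) (ψ (s g))]

/-- One factor from the augmentation ideal is expanded in the generators `S`; its coefficients are
absorbed into the other factor, which stays in the n-th power because that is an ideal. -/
lemma extendFun_eq_zero_of_le_span (χ : G → ℤ) {S : Set (AddMonoidAlgebra ℤ G)}
    (hS : augIdeal G ≤ Ideal.span S) {n : ℕ}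
    (h : ∀ a ∈ augIdeal G ^ n, ∀ x ∈ S, extendFun χ (a * x) = 0) {r : AddMonoidAlgebra ℤ G}
    (hr : r ∈ augIdeal G ^ (n + 1)) : extendFun χ r = 0 := by
  rw [pow_succ] at hr
  induction hr using Submodule.mul_induction_on' with
  | add x _ y _ hx hy => rw [map_add, hx, hy, add_zero]
  | mem_mul_mem a ha b hb =>
    have hb' := hS hb
    clear hb
    induction hb' using Submodule.span_induction generalizing a with
    | zero => rw [mul_zero, map_zero]
    | add x y _ _ hx hy => rw [mul_add, map_add, hx a ha, hy a ha, add_zero]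
    | smul c x _ hx =>
      rw [smul_eq_mul, ← mul_assoc]
      exact hx _ (Ideal.mul_mem_right _ _ ha)
    | mem x hx => exact h a ha x hx

/-- The map `g ↦ [g] - 1` is additive modulo the square of the augmentation ideal. -/
noncomputable def augHom (G : Type*) [AddCommGroup G] :
    G →+ AddMonoidAlgebra ℤ G ⧸ augIdeal G ^ 2 :=
  AddMonoidHom.mk' (fun g => Ideal.Quotient.mk _ (AddMonoidAlgebra.single g 1 - 1)) fun g h => by
    rw [← map_add, Ideal.Quotient.eq, sq]
    -- The defect of additivity is exactly ([g] - 1)([h] - 1).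
    have := Ideal.mul_mem_mul (single_sub_one_mem_augIdeal g) (single_sub_one_mem_augIdeal h)
    convert this using 1
    have : (AddMonoidAlgebra.single (g + h) 1 : AddMonoidAlgebra ℤ G) =
        AddMonoidAlgebra.single g 1 * AddMonoidAlgebra.single h 1 := by
      rw [AddMonoidAlgebra.single_mul_single, one_mul]
    rw [this]
    ring

/-- Since 1 - [-g] is the negative of [-g] - 1, additivity modulo I² makes backward and forward
differences agree. -/
lemma mk_diffElt (g : G) : Ideal.Quotient.mk (augIdeal G ^ 2) (diffElt g) = augHom G g := by
  rw [← neg_neg g, map_neg (augHom G), neg_neg, diffElt, ← neg_sub, map_neg]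
  rfl

end GroupRing

/-! ### Iterated differences of Ehrhart polynomials -/

section Ehrhart

variable {N : Type u} [AddCommGroup N] {F : Set (Set (RealSpace N))}

lemma eq_sum_rayValue_smul_courant [Fintype (Ray F)] (hF : IsUnimodularFan F) (f : PL F) :
    f = ∑ ρ, rayValue hF f ρ • courant hF ρ := by
  classical
  let v : PL F →+ (Ray F → ℤ) := AddMonoidHom.mk' (rayValue hF) (rayValue_add hF)
  refine PL_ext hF fun κ => ?_
  change v f κ = v (∑ ρ, rayValue hF f ρ • courant hF ρ) κ
  have hv : ∀ ρ, v (courant hF ρ) κ = if κ = ρ then 1 else 0 := fun ρ =>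
    rayValue_courant hF ρ κ
  simp only [map_sum, map_zsmul, Finset.sum_apply, Pi.smul_apply, hv]
  simp [v]

/-- For any ideal J, the g with [g] - 1 in J form a subgroup. Here it contains the Courant classes,
which generate the whole group. -/
lemma augIdeal_le_span_courant (hF : IsUnimodularFan F) :
    augIdeal (UPL F) ≤ Ideal.span (Set.range fun ρ : Ray F => diffElt (cls (courant hF ρ))) := by
  have := hF.toIsRationalFan.finite_ray
  have := Fintype.ofFinite (Ray F)
  set J := Ideal.span (Set.range fun ρ : Ray F => diffElt (cls (courant hF ρ)))
  let A : AddSubgroup (UPL F) :=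
    { carrier := {g | AddMonoidAlgebra.single g 1 - 1 ∈ J}
      zero_mem' := by simp [AddMonoidAlgebra.one_def]
      add_mem' := fun {g h} hg hh => by
        have e : (AddMonoidAlgebra.single (g + h) 1 - 1 : AddMonoidAlgebra ℤ (UPL F)) =
            AddMonoidAlgebra.single g 1 * (AddMonoidAlgebra.single h 1 - 1) +
              (AddMonoidAlgebra.single g 1 - 1) := by
          rw [mul_sub, AddMonoidAlgebra.single_mul_single, one_mul]
          ring
        rw [Set.mem_ofPred_eq, e]
        exact J.add_mem (J.mul_mem_left _ hh) hg
      neg_mem' := fun {g} hg => by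
        have e : (AddMonoidAlgebra.single (-g) 1 - 1 : AddMonoidAlgebra ℤ (UPL F)) =
            -(AddMonoidAlgebra.single (-g) 1 * (AddMonoidAlgebra.single g 1 - 1)) := by
          rw [mul_sub, AddMonoidAlgebra.single_mul_single, neg_add_cancel, one_mul,
            ← AddMonoidAlgebra.one_def]
          ring
        rw [Set.mem_ofPred_eq, e]
        exact J.neg_mem (J.mul_mem_left _ hg) }
  have hA : ∀ ρ, cls (courant hF ρ) ∈ A := fun ρ => by
    -- The generators of J are backward differences 1 - [-δ_ρ], so what is visibly in the subgroup
    -- is the inverse of the Courant class.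
    rw [← neg_mem_iff]
    change AddMonoidAlgebra.single _ 1 - 1 ∈ J
    rw [← neg_mem_iff, neg_sub]
    exact Ideal.subset_span ⟨ρ, rfl⟩
  rw [augIdeal, Ideal.span_le]
  rintro _ ⟨g, rfl⟩
  obtain ⟨f, rfl⟩ := QuotientAddGroup.mk_surjective g
  change (f : UPL F) ∈ A
  rw [eq_sum_rayValue_smul_courant hF f]
  change cls (∑ ρ, rayValue hF f ρ • courant hF ρ) ∈ A
  rw [map_sum]
  exact A.sum_mem fun ρ _ => by rw [map_zsmul]; exact A.zsmul_mem (hA ρ) _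

/-- Distinct adjacent rays have distinct images, so a squarefree product stays squarefree and the
induction over star fans can continue with finsets of rays. -/
lemma exists_prod_starClass_eq (hF : IsUnimodularFan F) {ρ : Ray F}
    (hS : IsUnimodularFan (starFan F ρ.1)) (T : Finset (Ray F)) (hT : ∀ ρ' ∈ T, Adjacent ρ ρ') :
    ∃ T' : Finset (Ray (starFan F ρ.1)),
      (∀ κ, κ ∈ T' ↔ ∃ ρ' ∈ T, ∃ h : Adjacent ρ ρ', linkRay hF h = κ) ∧
      AddMonoidAlgebra.mapDomainRingHom ℤ (starClass hF.toIsRationalFan ρ.2.1)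
        (∏ ρ' ∈ T, diffElt (cls (courant hF ρ'))) =
          ∏ κ ∈ T', diffElt (cls (courant hS κ)) := by
  classical
  refine ⟨T.attach.image fun ρ' => linkRay hF (hT ρ'.1 ρ'.2), fun κ => ?_, ?_⟩
  · simp only [Finset.mem_image, Finset.mem_attach, true_and]
    exact ⟨fun ⟨ρ', e⟩ => ⟨ρ'.1, ρ'.2, hT ρ'.1 ρ'.2, e⟩, fun ⟨ρ', h, _, e⟩ => ⟨⟨ρ', h⟩, e⟩⟩
  · rw [map_prod, Finset.prod_image, ← Finset.prod_attach]
    · refine Finset.prod_congr rfl fun ρ' _ => ?_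
      rw [map_diffElt, starClass_courant_of_adjacent hF hS (hT ρ'.1 ρ'.2)]
    · intro ρ₁ _ ρ₂ _ h
      exact Subtype.ext (linkRay_injective hF hS _ _ h)

lemma IsEhrhartPolynomial.isUnimodularFan {χ : UPL F → ℤ} (hχ : IsEhrhartPolynomial F χ) :
    IsUnimodularFan F := by
  cases hχ
  assumption

lemma extendFun_mul_diffElt_courant (hF : IsUnimodularFan F) {χ : UPL F → ℤ}
    {ρ : Ray F} {χstar : UPL (starFan F ρ.1) → ℤ}
    (h : ∀ f : PL F, χ (cls f) = χ (cls (f - courant hF ρ)) +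
      χstar (starClass hF.toIsRationalFan ρ.2.1 (cls f))) (r : AddMonoidAlgebra ℤ (UPL F)) :
    extendFun χ (r * diffElt (cls (courant hF ρ))) = extendFun χstar
      (AddMonoidAlgebra.mapDomainRingHom ℤ (starClass hF.toIsRationalFan ρ.2.1) r) := by
  refine extendFun_mul_diffElt (fun g => ?_) r
  obtain ⟨f, rfl⟩ := QuotientAddGroup.mk_surjective g
  exact h f

/-- Removing the factor of a ray ρ of `T` moves the remaining product to the star fan at ρ. If the
other rays are all adjacent to ρ, their images are again a non-face; if one is not, its Courant
class becomes 0 and its factor vanishes. The set `T` is nonempty because the zero cone belongs to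
the fan. -/
theorem IsEhrhartPolynomial.extendFun_mul_prod_eq_zero {χ : UPL F → ℤ}
    (hχ : IsEhrhartPolynomial F χ) (hF : IsUnimodularFan F) (T : Finset (Ray F))
    (hT : ¬ ∃ σ ∈ F, ∀ ρ ∈ T, ρ.1 ⊆ σ) (r : AddMonoidAlgebra ℤ (UPL F)) :
    extendFun χ (r * ∏ ρ ∈ T, diffElt (cls (courant hF ρ))) = 0 := by
  classical
  induction hχ with
  | intro F _ χ χstar star _ recursion ih =>
    obtain ⟨ρ, hρ⟩ : T.Nonempty := by
      rw [Finset.nonempty_iff_ne_empty]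
      rintro rfl
      exact hT ⟨{0}, hF.pointed, by simp⟩
    have hS := (star ρ).isUnimodularFan
    rw [← Finset.prod_erase_mul _ _ hρ, ← mul_assoc,
      extendFun_mul_diffElt_courant hF (fun f => recursion f ρ), map_mul]
    by_cases hadj : ∀ ρ' ∈ T.erase ρ, Adjacent ρ ρ'
    · obtain ⟨T', hT', e⟩ := exists_prod_starClass_eq hF hS _ hadj
      rw [e]
      refine ih ρ hS T' ?_ _
      rintro ⟨κ, hκ, hsub⟩
      obtain ⟨σ, hσ, hρσ, H⟩ := exists_cone_of_linkRay_subset hF hκ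
      refine hT ⟨σ, hσ, fun ρ' hρ' => ?_⟩
      by_cases hne : ρ' = ρ
      · rw [hne]; exact hρσ
      · have hmem := Finset.mem_erase.2 ⟨hne, hρ'⟩
        exact H ρ' (hadj ρ' hmem) (hsub _ ((hT' _).2 ⟨ρ', hmem, hadj ρ' hmem, rfl⟩))
    · push Not at hadj
      obtain ⟨ρ', hρ', hn⟩ := hadj
      rw [map_prod, Finset.prod_eq_zero hρ', mul_zero, map_zero]
      rw [map_diffElt, starClass_courant_of_not_adjacent hF hS (Finset.ne_of_mem_erase hρ') hn,
        diffElt_zero]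

/-- Removing a ray passes to the star fan, where the remaining rays still lie on a common cone. The
process ends with the empty product, whose value is χ(0) = 1. -/
theorem IsEhrhartPolynomial.extendFun_prod_eq_one {χ : UPL F → ℤ}
    (hχ : IsEhrhartPolynomial F χ) (hF : IsUnimodularFan F) (T : Finset (Ray F))
    (hT : ∃ σ ∈ F, ∀ ρ ∈ T, ρ.1 ⊆ σ) :
    extendFun χ (∏ ρ ∈ T, diffElt (cls (courant hF ρ))) = 1 := by
  classical
  induction hχ with
  | intro F _ χ χstar star zero recursion ih =>
    obtain rfl | ⟨ρ, hρ⟩ := T.eq_empty_or_nonempty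
    · rw [Finset.prod_empty, extendFun_one, zero]
    obtain ⟨σ, hσ, hsub⟩ := hT
    have hS := (star ρ).isUnimodularFan
    have hadj : ∀ ρ' ∈ T.erase ρ, Adjacent ρ ρ' := fun ρ' h =>
      ⟨Finset.ne_of_mem_erase h, σ, hσ, hsub ρ hρ, hsub ρ' (Finset.mem_of_mem_erase h)⟩
    obtain ⟨T', hT', e⟩ := exists_prod_starClass_eq hF hS _ hadj
    rw [← Finset.prod_erase_mul _ _ hρ,
      extendFun_mul_diffElt_courant hF (fun f => recursion f ρ), e]
    refine ih ρ hS T' ⟨_, starFan_mem_of_subset hF.toIsRationalFan hσ (hsub ρ hρ), ?_⟩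
    intro κ hκ
    obtain ⟨ρ', hρ', h, rfl⟩ := (hT' κ).1 hκ
    rw [linkRay_val]
    exact Set.image_mono (hsub ρ' (Finset.mem_of_mem_erase hρ'))

/-- One factor of the ideal power may be taken to be a Courant difference. Using it up lowers both
the exponent and the dimension bound by one. -/
theorem IsEhrhartPolynomial.extendFun_eq_zero {χ : UPL F → ℤ}
    (hχ : IsEhrhartPolynomial F χ) {n : ℕ} (hn : ∀ σ ∈ F, coneDim σ ≤ n)
    {r : AddMonoidAlgebra ℤ (UPL F)} (hr : r ∈ augIdeal (UPL F) ^ (n + 1)) :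
    extendFun χ r = 0 := by
  induction hχ generalizing n with
  | intro F hF χ χstar star zero recursion ih =>
    refine extendFun_eq_zero_of_le_span χ (augIdeal_le_span_courant hF) ?_ hr
    rintro a ha _ ⟨ρ, rfl⟩
    rw [extendFun_mul_diffElt_courant hF (fun f => recursion f ρ)]
    obtain _ | n := n
    -- The induction bottoms out here: a zero-dimensional fan has no rays.
    · exact absurd (hn ρ.1 ρ.2.1) (by rw [ρ.2.2]; omega)
    · exact ih ρ (coneDim_starFan_le hF hn ρ) (map_mem_augIdeal_pow _ ha)

end Ehrhart

/-! ### Monomials and homogeneous polynomials -/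

section MvPolynomial

open MvPolynomial

lemma prod_pow_mem_pow_sum {ι A : Type*} [CommRing A] {I : Ideal A} (s : Finset ι) {x : ι → A}
    (hx : ∀ i, x i ∈ I) (α : ι → ℕ) : ∏ i ∈ s, x i ^ α i ∈ I ^ ∑ i ∈ s, α i := by
  rw [← Finset.prod_pow_eq_pow_sum]
  exact Ideal.prod_mem_prod fun i _ => Ideal.pow_mem_pow (hx i) _

lemma eval₂_mem_pow_of_isHomogeneous {ι R A : Type*} [CommRing R] [CommRing A] (f : R →+* A)
    (x : ι → A) {I : Ideal A} (hx : ∀ i, x i ∈ I) {k : ℕ} {p : MvPolynomial ι R}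
    (hp : p.IsHomogeneous k) : eval₂Hom f x p ∈ I ^ k := by
  rw [p.as_sum, map_sum]
  refine Ideal.sum_mem _ fun α hα => ?_
  rw [eval₂Hom_monomial]
  refine Ideal.mul_mem_left _ _ ?_
  have hk : α.degree = k := by
    by_contra h
    exact (mem_support_iff.1 hα) (hp.coeff_eq_zero h)
  rw [← hk, Finsupp.degree_apply]
  exact prod_pow_mem_pow_sum _ hx α

lemma addMonoidHom_eq_zero_of_mem_span {ι R A : Type*} [CommRing R] [AddCommGroup A]
    (φ : MvPolynomial ι R →+ A) {S : Set (MvPolynomial ι R)}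
    (h : ∀ s ∈ S, ∀ α c, φ (monomial α c * s) = 0) {p : MvPolynomial ι R}
    (hp : p ∈ Ideal.span S) : φ p = 0 := by
  -- As φ is only additive, the induction over the ideal must carry all multiples along.
  suffices H : ∀ q, φ (q * p) = 0 by simpa using H 1
  induction hp using Submodule.span_induction with
  | zero => simp
  | add x y _ _ hx hy => intro q; rw [mul_add, map_add, hx, hy, add_zero]
  | smul c x _ hx => intro q; rw [smul_eq_mul, ← mul_assoc, hx]
  | mem s hs =>
    intro q
    rw [q.as_sum, Finset.sum_mul, map_sum]
    exact Finset.sum_eq_zero fun α _ => h s hs _ _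

lemma card_support_le_degree {ι : Type*} (α : ι →₀ ℕ) : α.support.card ≤ α.degree := by
  rw [Finsupp.degree_apply, Finset.card_eq_sum_ones]
  exact Finset.sum_le_sum fun i hi => Nat.one_le_iff_ne_zero.2 (Finsupp.mem_support_iff.1 hi)

end MvPolynomial

/-! ### Cones and their rays -/

section Rays

variable {N : Type u} [AddCommGroup N] {F : Set (Set (RealSpace N))}

lemma rayGenerator_injective (hF : IsUnimodularFan F) : Function.Injective (rayGenerator hF) := by
  intro ρ₁ ρ₂ h
  apply Subtype.ext
  ext v
  rw [mem_ray_iff hF, mem_ray_iff hF, h]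

lemma card_rays_eq_coneDim (hF : IsUnimodularFan F) {σ : Set (RealSpace N)} (hσ : σ ∈ F)
    {T : Finset (Ray F)} (hT : ∀ ρ, ρ ∈ T ↔ ρ.1 ⊆ σ) : T.card = coneDim σ := by
  classical
  obtain ⟨b, S, rfl⟩ := hF.unimodular _ hσ
  rw [coneDim_genCone, ← Finset.card_image_of_injective T (rayGenerator_injective hF),
    ← Finset.card_image_of_injective S b.injective]
  congr 1
  ext n
  simp only [Finset.mem_image, hT]
  constructor
  · rintro ⟨ρ, hρ, rfl⟩
    obtain ⟨i, hi, -, h⟩ := hF.ray_eq_of_subset b hσ ρ hρ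
    exact ⟨i, hi, h.symm⟩
  · rintro ⟨i, hi, rfl⟩
    obtain ⟨ρ, -, hρ, h⟩ := hF.exists_ray b hσ hi
    exact ⟨ρ, hρ, h⟩

/-- In a unimodular cone every subset of the generators spans a face. -/
lemma exists_cone_of_rays (hF : IsUnimodularFan F) {T : Finset (Ray F)}
    (hT : ∃ σ ∈ F, ∀ ρ ∈ T, ρ.1 ⊆ σ) : ∃ σ ∈ F, ∀ ρ, ρ ∈ T ↔ ρ.1 ⊆ σ := by
  classical
  obtain ⟨σ, hσ, hsub⟩ := hT
  obtain ⟨b, S, rfl⟩ := hF.unimodular _ hσ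
  let S' := S.filter fun i => ∃ ρ ∈ T, rayGenerator hF ρ = b i
  have hS' : genCone b S' ∈ F :=
    hF.face_mem _ hσ _ (isFace_genCone b (Finset.filter_subset _ _))
  refine ⟨_, hS', fun ρ => ⟨fun hρ => ?_, fun hρ => ?_⟩⟩
  · obtain ⟨i, hi, -, h⟩ := hF.ray_eq_of_subset b hσ ρ (hsub ρ hρ)
    rw [ray_subset_iff hF ρ hS', h]
    exact lat_mem_genCone b (Finset.mem_filter.2 ⟨hi, ρ, hρ, h⟩)
  · obtain ⟨i, hi, -, h⟩ := hF.ray_eq_of_subset b hS' ρ hρ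
    obtain ⟨-, ρ', hρ', h'⟩ := Finset.mem_filter.1 hi
    rwa [← rayGenerator_injective hF (h'.trans h.symm)]

end Rays

/-! ### Generators of the Chow ring -/

section Chow

variable {N : Type u} [AddCommGroup N] {F : Set (Set (RealSpace N))}

open MvPolynomial

lemma chowMk_prod_X_eq_zero (hF : IsUnimodularFan F) {T : Finset (Ray F)}
    (hT : ¬ ∃ σ ∈ F, ∀ ρ ∈ T, ρ.1 ⊆ σ) : chowMk hF (∏ ρ ∈ T, X ρ) = 0 :=
  Ideal.Quotient.eq_zero_iff_mem.2 (Ideal.mem_sup_left (Ideal.subset_span ⟨T, hT, rfl⟩))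

lemma chowMk_linearPoly_eq_zero (hF : IsUnimodularFan F) (m : Module.Dual ℤ N) :
    chowMk hF (linearPoly fun ρ : Ray F => m (rayGenerator hF ρ)) = 0 :=
  Ideal.Quotient.eq_zero_iff_mem.2 (Ideal.mem_sup_right (Ideal.subset_span ⟨m, rfl⟩))

/-- The classes of the squarefree monomials of degree `d` given by the cones of the fan. -/
def coneClasses (hF : IsUnimodularFan F) (d : ℕ) : Set (ChowRing hF) :=
  {a | ∃ T : Finset (Ray F), T.card = d ∧ (∃ σ ∈ F, ∀ ρ ∈ T, ρ.1 ⊆ σ) ∧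
    a = chowMk hF (∏ ρ ∈ T, X ρ)}

/-- Repeated factors can be moved away by linear relations. If ρ₀ has exponent at least 2,
unimodularity gives m with value 1 at ρ₀ and 0 at the other rays of the support. The relation of m
trades one factor x_ρ₀ for variables outside the support, so the support grows; it has at most d
elements, which ends the induction. -/
lemma chowMk_monomial_mem_closure (hF : IsUnimodularFan F) {d : ℕ} (α : Ray F →₀ ℕ)
    (hα : α.degree = d) :
    chowMk hF (monomial α 1) ∈ AddSubgroup.closure (coneClasses hF d) := by
  classical
  have := hF.toIsRationalFan.finite_ray
  have := Fintype.ofFinite (Ray F)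
  induction hk : d - α.support.card using Nat.strong_induction_on generalizing α with
  | _ k ih =>
    by_cases hface : ∃ σ ∈ F, ∀ ρ ∈ α.support, ρ.1 ⊆ σ
    swap
    · have hdvd : ∏ ρ ∈ α.support, (X ρ : MvPolynomial (Ray F) ℤ) ∣ monomial α 1 := by
        rw [monomial_eq, C_1, one_mul]
        exact Finset.prod_dvd_prod_of_dvd _ _ fun ρ hρ =>
          dvd_pow_self _ (Finsupp.mem_support_iff.1 hρ)
      obtain ⟨q, hq⟩ := hdvd
      rw [hq, map_mul, chowMk_prod_X_eq_zero hF hface, zero_mul]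
      exact zero_mem _
    by_cases hone : ∀ ρ ∈ α.support, α ρ = 1
    · refine AddSubgroup.subset_closure ⟨α.support, ?_, hface, ?_⟩
      · rw [← hα, Finsupp.degree_apply, Finset.card_eq_sum_ones]
        exact Finset.sum_congr rfl fun ρ hρ => (hone ρ hρ).symm
      · rw [monomial_eq, C_1, one_mul, Finsupp.prod]
        exact congrArg _ (Finset.prod_congr rfl fun ρ hρ => by rw [hone ρ hρ, pow_one])
    push Not at hone
    obtain ⟨ρ₀, hρ₀, hne⟩ := hone
    obtain ⟨σ, hσ, hsub⟩ := hface
    obtain ⟨m, hm⟩ := exists_dual_eq hF hσ (fun ρ => if ρ = ρ₀ then 1 else 0)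
    have h2 : 2 ≤ α ρ₀ := by
      have := Finsupp.mem_support_iff.1 hρ₀
      omega
    set β := α - Finsupp.single ρ₀ 1
    have hαβ : β + Finsupp.single ρ₀ 1 = α :=
      tsub_add_cancel_of_le (Finsupp.single_le_iff.2 (by omega))
    have hrel := congrArg (· * chowMk hF (monomial β 1)) (chowMk_linearPoly_eq_zero hF m)
    simp only [zero_mul] at hrel
    rw [linearPoly, finsum_eq_sum_of_fintype, ← map_mul, Finset.sum_mul, map_sum,
      ← Finset.add_sum_erase _ _ (Finset.mem_univ ρ₀)] at hrel
    have hterm : ∀ ρ, chowMk hF (C (m (rayGenerator hF ρ)) * X ρ * monomial β 1) =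
        m (rayGenerator hF ρ) • chowMk hF (monomial (β + Finsupp.single ρ 1) 1) := by
      intro ρ
      rw [← map_zsmul, mul_assoc, ← C_mul', mul_comm (X ρ), monomial_add_single, pow_one]
    simp only [hterm] at hrel
    rw [hm ρ₀ (hsub ρ₀ hρ₀), if_pos rfl, one_smul, hαβ] at hrel
    rw [eq_neg_of_add_eq_zero_left hrel]
    refine neg_mem (sum_mem fun ρ hρ => ?_)
    by_cases hρα : ρ ∈ α.support
    · rw [hm ρ (hsub ρ hρα), if_neg (Finset.ne_of_mem_erase hρ), zero_smul]
      exact zero_mem _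
    refine zsmul_mem ?_ _
    have hdeg : (β + Finsupp.single ρ 1).degree = d := by
      rw [← hα, ← hαβ, map_add, map_add, Finsupp.degree_single, Finsupp.degree_single]
    -- Because ρ₀ had exponent at least 2, it is still in the support after losing one factor.
    have hsupp : α.support.card < (β + Finsupp.single ρ 1).support.card := by
      refine Finset.card_lt_card (Finset.ssubset_iff.2 ⟨ρ, hρα, ?_⟩)
      intro κ hκ
      rw [Finsupp.mem_support_iff, Finsupp.add_apply]
      rcases Finset.mem_insert.1 hκ with rfl | hκ
      · simp
      · have h0 := Finsupp.mem_support_iff.1 hκ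
        have : β κ = α κ - Finsupp.single ρ₀ 1 κ := rfl
        rw [Finsupp.single_apply] at this
        split_ifs at this with he
        · subst he; omega
        · omega
    have hle := card_support_le_degree (β + Finsupp.single ρ 1)
    rw [hdeg] at hle
    exact ih _ (by omega) _ hdeg rfl

lemma chowPiece_le_closure (hF : IsUnimodularFan F) (d : ℕ) :
    chowPiece hF d ≤ AddSubgroup.closure (coneClasses hF d) := by
  rintro _ ⟨p, hp, rfl⟩
  change chowMk hF p ∈ _
  replace hp : p.IsHomogeneous d := hp
  rw [p.as_sum, map_sum]
  refine sum_mem fun α hα => ?_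
  have hk : α.degree = d := by
    by_contra h
    exact (mem_support_iff.1 hα) (hp.coeff_eq_zero h)
  rw [← mul_one (coeff α p), ← smul_eq_mul, ← smul_monomial, map_zsmul]
  exact zsmul_mem (chowMk_monomial_mem_closure hF α hk) _

theorem IsDegreeMap.unique {hF : IsUnimodularFan F} {d : ℕ} {deg₁ deg₂ : chowPiece hF d →+ ℤ}
    (h₁ : IsDegreeMap hF d deg₁) (h₂ : IsDegreeMap hF d deg₂) : deg₁ = deg₂ := by
  have hsub : coneClasses hF d ⊆ chowPiece hF d := by
    rintro _ ⟨T, rfl, -, rfl⟩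
    exact chowMk_mem hF (isHomogeneous_prod_X T)
  have hle : AddSubgroup.closure (coneClasses hF d) ≤ chowPiece hF d :=
    (AddSubgroup.closure_le _).2 hsub
  have key : ∀ a ∈ AddSubgroup.closure (coneClasses hF d), ∀ ha : a ∈ chowPiece hF d,
      deg₁ ⟨a, ha⟩ = deg₂ ⟨a, ha⟩ := by
    intro a ha
    induction ha using AddSubgroup.closure_induction with
    | zero =>
      intro ha
      exact (map_zero deg₁).trans (map_zero deg₂).symm
    | add x y hx hy ihx ihy =>
      intro ha
      have e : (⟨x + y, ha⟩ : chowPiece hF d) = ⟨x, hle hx⟩ + ⟨y, hle hy⟩ := rfl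
      rw [e, map_add, map_add, ihx, ihy]
    | neg x hx ih =>
      intro ha
      have e : (⟨-x, ha⟩ : chowPiece hF d) = -⟨x, hle hx⟩ := rfl
      rw [e, map_neg, map_neg, ih]
    | mem x hx =>
      intro ha
      obtain ⟨T, hT, hface, rfl⟩ := hx
      -- The normalization concerns full ray sets of cones, so the given cone is replaced by its
      -- face with ray set exactly `T`.
      obtain ⟨σ, hσ, hσT⟩ := exists_cone_of_rays hF hface
      have hdim : coneDim σ = d := (card_rays_eq_coneDim hF hσ hσT).symm.trans hT
      exact (h₁ σ hσ hdim T hσT hT).trans (h₂ σ hσ hdim T hσT hT).symm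
  ext ⟨a, ha⟩
  exact key a (chowPiece_le_closure hF d ha) ha

end Chow

/-! ### The degree map of an Ehrhart fan -/

section Degree

variable {N : Type u} [AddCommGroup N] {F : Set (Set (RealSpace N))}

open MvPolynomial

/-- The ring homomorphism that sends the variable of a ray to the difference operator in the
direction of its Courant function. -/
noncomputable def diffHom (hF : IsUnimodularFan F) :
    MvPolynomial (Ray F) ℤ →+* AddMonoidAlgebra ℤ (UPL F) :=
  eval₂Hom (Int.castRingHom _) fun ρ => diffElt (cls (courant hF ρ))

lemma diffHom_X (hF : IsUnimodularFan F) (ρ : Ray F) :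
    diffHom hF (X ρ) = diffElt (cls (courant hF ρ)) :=
  eval₂Hom_X' _ _ _

lemma diffHom_mem (hF : IsUnimodularFan F) {k : ℕ} {p : MvPolynomial (Ray F) ℤ}
    (hp : p.IsHomogeneous k) : diffHom hF p ∈ augIdeal (UPL F) ^ k :=
  eval₂_mem_pow_of_isHomogeneous _ _ (fun _ => diffElt_mem_augIdeal _) hp

/-- Modulo I², both terms are the image of cls f under the additive map `augHom`, computed on the
expansion of f in Courant functions. -/
lemma diffHom_linearPoly (hF : IsUnimodularFan F) (f : PL F) :
    diffHom hF (linearPoly (rayValue hF f)) - (AddMonoidAlgebra.single (cls f) 1 - 1) ∈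
      augIdeal (UPL F) ^ 2 := by
  have := hF.toIsRationalFan.finite_ray
  have := Fintype.ofFinite (Ray F)
  rw [← Ideal.Quotient.eq]
  change _ = augHom (UPL F) (cls f)
  conv_rhs => rw [eq_sum_rayValue_smul_courant hF f]
  rw [linearPoly, finsum_eq_sum_of_fintype]
  simp only [map_sum, map_zsmul, ← mk_diffElt, ← diffHom_X]
  refine Finset.sum_congr rfl fun ρ _ => ?_
  rw [C_mul', map_zsmul, map_zsmul]

lemma diffHom_linearPoly_dual_mem (hF : IsUnimodularFan F) (m : Module.Dual ℤ N) :
    diffHom hF (linearPoly fun ρ : Ray F => m (rayGenerator hF ρ)) ∈ augIdeal (UPL F) ^ 2 := by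
  have h := diffHom_linearPoly hF (restrictLinear F m)
  have h0 : cls (restrictLinear F m) = 0 := (QuotientAddGroup.eq_zero_iff _).2 ⟨m, rfl⟩
  rwa [h0, ← AddMonoidAlgebra.one_def, sub_self, sub_zero,
    show rayValue hF (restrictLinear F m) = fun ρ => m (rayGenerator hF ρ) from
      funext (rayValue_restrictLinear hF m)] at h

/-- The functional on polynomials that induces the degree map. -/
noncomputable def degreeFunctional (hF : IsUnimodularFan F) (χ : UPL F → ℤ) (d : ℕ) :
    MvPolynomial (Ray F) ℤ →+ ℤ :=
  (extendFun χ).toAddMonoidHom.comp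
    ((diffHom hF).toAddMonoidHom.comp (homogeneousComponent d).toAddMonoidHom)

lemma degreeFunctional_of_isHomogeneous (hF : IsUnimodularFan F) (χ : UPL F → ℤ) {d : ℕ}
    {p : MvPolynomial (Ray F) ℤ} (hp : p.IsHomogeneous d) :
    degreeFunctional hF χ d p = extendFun χ (diffHom hF p) := by
  change extendFun χ (diffHom hF (homogeneousComponent d p)) = _
  rw [homogeneousComponent_of_mem hp, if_pos rfl]

lemma degreeFunctional_of_isHomogeneous_ne (hF : IsUnimodularFan F) (χ : UPL F → ℤ) {d k : ℕ}
    {p : MvPolynomial (Ray F) ℤ} (hp : p.IsHomogeneous k) (h : d ≠ k) :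
    degreeFunctional hF χ d p = 0 := by
  change extendFun χ (diffHom hF (homogeneousComponent d p)) = _
  rw [homogeneousComponent_of_mem hp, if_neg h, map_zero, map_zero]

/-- Monomial multiples of the generators are homogeneous, so only those of degree d matter. Non-face
products vanish under χ; a linear relation lies in I² and its cofactor in I^(d-1), which puts the
product in I^(d+1). -/
lemma degreeFunctional_eq_zero {hF : IsUnimodularFan F} {χ : UPL F → ℤ}
    (hχ : IsEhrhartPolynomial F χ) {d : ℕ} (hd : ∀ σ ∈ F, coneDim σ ≤ d)
    {p : MvPolynomial (Ray F) ℤ} (hp : p ∈ stanleyReisnerIdeal F ⊔ linearIdeal hF) :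
    degreeFunctional hF χ d p = 0 := by
  rw [stanleyReisnerIdeal, linearIdeal, ← Ideal.span_union] at hp
  refine addMonoidHom_eq_zero_of_mem_span _ ?_ hp
  rintro s (⟨T, hT, rfl⟩ | ⟨m, rfl⟩) α c
  · have hh := (isHomogeneous_monomial c (rfl : α.degree = α.degree)).mul
      (isHomogeneous_prod_X T)
    by_cases h : d = α.degree + T.card
    · subst h
      rw [degreeFunctional_of_isHomogeneous hF χ hh, map_mul, map_prod]
      simp only [diffHom_X]
      exact hχ.extendFun_mul_prod_eq_zero hF T hT _
    · exact degreeFunctional_of_isHomogeneous_ne hF χ hh h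
  · have hc := isHomogeneous_monomial c (rfl : α.degree = α.degree)
    have hh := hc.mul (linearPoly_isHomogeneous fun ρ : Ray F => m (rayGenerator hF ρ))
    by_cases h : d = α.degree + 1
    · subst h
      rw [degreeFunctional_of_isHomogeneous hF χ hh, map_mul]
      refine hχ.extendFun_eq_zero hd ?_
      have := Ideal.mul_mem_mul (diffHom_mem hF hc) (diffHom_linearPoly_dual_mem hF m)
      exact (pow_add (augIdeal (UPL F)) α.degree 2).ge this
    · exact degreeFunctional_of_isHomogeneous_ne hF χ hh h

/-- The functional descends to the Chow ring and is then restricted to degree d. The explicit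
formula is kept in the conclusion for the computation of the volume. -/
theorem IsEhrhartPolynomial.exists_degreeMap {χ : UPL F → ℤ} (hχ : IsEhrhartPolynomial F χ)
    (hF : IsUnimodularFan F) {d : ℕ} (hd : ∀ σ ∈ F, coneDim σ ≤ d) :
    ∃ deg : chowPiece hF d →+ ℤ, IsDegreeMap hF d deg ∧
      ∀ (p : MvPolynomial (Ray F) ℤ) (hp : p.IsHomogeneous d),
        deg ⟨chowMk hF p, chowMk_mem hF hp⟩ = extendFun χ (diffHom hF p) := by
  have hker : (chowMk hF).toAddMonoidHom.ker ≤ (degreeFunctional hF χ d).ker := fun p hp =>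
    degreeFunctional_eq_zero hχ hd (Ideal.Quotient.eq_zero_iff_mem.1 hp)
  have hsurj : Function.Surjective (chowMk hF).toAddMonoidHom := Ideal.Quotient.mk_surjective
  let deg : chowPiece hF d →+ ℤ :=
    ((chowMk hF).toAddMonoidHom.liftOfSurjective hsurj ⟨_, hker⟩).comp (chowPiece hF d).subtype
  have hdeg : ∀ (p : MvPolynomial (Ray F) ℤ) (hp : p.IsHomogeneous d),
      deg ⟨chowMk hF p, chowMk_mem hF hp⟩ = extendFun χ (diffHom hF p) := fun p hp => by
    rw [← degreeFunctional_of_isHomogeneous hF χ hp]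
    exact AddMonoidHom.liftOfRightInverse_comp_apply _ _ (Function.rightInverse_surjInv hsurj)
      ⟨degreeFunctional hF χ d, hker⟩ p
  refine ⟨deg, fun σ hσ _ T hT hcard => ?_, hdeg⟩
  rw [hdeg _ (hcard ▸ isHomogeneous_prod_X T), map_prod]
  simp only [diffHom_X]
  exact hχ.extendFun_prod_eq_one hF T ⟨σ, hσ, fun ρ hρ => (hT ρ).1 hρ⟩

end Degree

/-! ### Integer powers of group elements modulo powers of the augmentation ideal -/

section Binomial

open Finset in
-- By Pascal's rule the truncated binomial series satisfies the same recursion as `e`, the overflow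
-- term being killed by y^(n+1) = 0. Since 1 + y is a unit, the recursion also determines the
-- negative values.
lemma eq_sum_choose_of_nilpotent {Q : Type*} [CommRing Q] {y : Q} {n : ℕ} (hy : y ^ (n + 1) = 0)
    {e : ℤ → Q} (h0 : e 0 = 1) (hs : ∀ z, e (z + 1) = (1 + y) * e z) (z : ℤ) :
    e z = ∑ k ∈ range (n + 1), Ring.choose z k • y ^ k := by
  have hB : ∀ z : ℤ, ∑ k ∈ range (n + 1), Ring.choose (z + 1) k • y ^ k =
      (1 + y) * ∑ k ∈ range (n + 1), Ring.choose z k • y ^ k := by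
    intro z
    rw [one_add_mul, sum_range_succ' (fun k => Ring.choose (z + 1) k • y ^ k)]
    nth_rewrite 1 [sum_range_succ' (fun k => Ring.choose z k • y ^ k)]
    rw [sum_range_succ (fun k => Ring.choose z k • y ^ k), mul_add, mul_smul_comm, ← pow_succ', hy,
      smul_zero, add_zero, mul_sum]
    simp only [Ring.choose_succ_succ, add_smul, sum_add_distrib, Ring.choose_zero_right,
      mul_smul_comm, ← pow_succ']
    ring
  have hu : IsUnit (1 + y) := IsNilpotent.isUnit_one_add ⟨_, hy⟩
  induction z with
  | zero =>
    rw [h0, sum_range_succ', sum_eq_zero]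
    · simp
    · intro k _
      rw [Ring.choose_zero_succ, zero_smul]
  | succ z ih => rw [hs, hB, ih]
  | pred z ih =>
    refine hu.mul_left_cancel ?_
    rw [← hs, ← hB, sub_add_cancel, ih]

lemma pow_sub_pow_mem {A : Type*} [CommRing A] {I : Ideal A} {a b : A} (hab : a - b ∈ I ^ 2)
    (hb : b ∈ I) (n : ℕ) : a ^ n - b ^ n ∈ I ^ (n + 1) := by
  have ha : a ∈ I := by
    have := I.add_mem (Ideal.pow_le_self two_ne_zero hab) hb
    rwa [sub_add_cancel] at this
  induction n with
  | zero => simp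
  | succ n ih =>
    -- Each summand gains the right power: I · I^(n+1) in the first, I² · I^n in the second.
    have e : a ^ (n + 1) - b ^ (n + 1) = a * (a ^ n - b ^ n) + (a - b) * b ^ n := by ring
    rw [e]
    refine Ideal.add_mem _ ?_ ?_
    · rw [pow_succ' I]
      exact Ideal.mul_mem_mul ha ih
    · rw [show n + 1 + 1 = 2 + n by ring, pow_add]
      exact Ideal.mul_mem_mul hab (Ideal.pow_mem_pow hb n)

variable {G : Type*} [AddCommGroup G]

lemma mk_single_zsmul (g : G) (n : ℕ) (z : ℤ) :
    Ideal.Quotient.mk (augIdeal G ^ (n + 1)) (AddMonoidAlgebra.single (z • g) 1) =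
      ∑ k ∈ Finset.range (n + 1), Ring.choose z k •
        Ideal.Quotient.mk (augIdeal G ^ (n + 1)) (AddMonoidAlgebra.single g 1 - 1) ^ k := by
  refine eq_sum_choose_of_nilpotent (e := fun z =>
    Ideal.Quotient.mk (augIdeal G ^ (n + 1)) (AddMonoidAlgebra.single (z • g) 1)) ?_ ?_ ?_ z
  · rw [← map_pow, Ideal.Quotient.eq_zero_iff_mem]
    exact Ideal.pow_mem_pow (single_sub_one_mem_augIdeal g) _
  · rw [zero_smul, ← AddMonoidAlgebra.one_def, map_one]
  · intro z
    rw [map_sub, map_one, add_sub_cancel, ← map_mul, AddMonoidAlgebra.single_mul_single, one_mul,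
      add_smul, one_smul, add_comm (z • g)]

lemma extendFun_eq_of_mk_eq {χ : G → ℤ} {n : ℕ}
    (hχ : ∀ r ∈ augIdeal G ^ (n + 1), extendFun χ r = 0) {a b : AddMonoidAlgebra ℤ G}
    (h : Ideal.Quotient.mk (augIdeal G ^ (n + 1)) a = Ideal.Quotient.mk _ b) :
    extendFun χ a = extendFun χ b := by
  rw [← sub_eq_zero, ← map_sub]
  exact hχ _ (Ideal.Quotient.eq.1 h)

lemma apply_zsmul_eq_sum_choose {χ : G → ℤ} {n : ℕ}
    (hχ : ∀ r ∈ augIdeal G ^ (n + 1), extendFun χ r = 0) (g : G) (z : ℤ) :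
    χ (z • g) = ∑ k ∈ Finset.range (n + 1),
      Ring.choose z k * extendFun χ ((AddMonoidAlgebra.single g 1 - 1) ^ k) := by
  have h : extendFun χ (AddMonoidAlgebra.single (z • g) 1) = extendFun χ
      (∑ k ∈ Finset.range (n + 1), Ring.choose z k • (AddMonoidAlgebra.single g 1 - 1) ^ k) := by
    refine extendFun_eq_of_mk_eq hχ ?_
    rw [mk_single_zsmul]
    simp only [map_sum, map_zsmul, map_pow]
  rw [extendFun_single, one_mul] at h
  rw [h, map_sum]
  simp only [map_zsmul, smul_eq_mul]

lemma single_sum {ι : Type*} (s : Finset ι) (g : ι → G) :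
    (AddMonoidAlgebra.single (∑ i ∈ s, g i) 1 : AddMonoidAlgebra ℤ G) =
      ∏ i ∈ s, AddMonoidAlgebra.single (g i) 1 := by
  classical
  induction s using Finset.induction_on with
  | empty => rfl
  | insert i s hi ih =>
    rw [Finset.sum_insert hi, Finset.prod_insert hi, ← ih, AddMonoidAlgebra.single_mul_single,
      one_mul]

lemma apply_sum_zsmul_eq_sum_choose {ι : Type*} [Fintype ι] [DecidableEq ι] {χ : G → ℤ} {n : ℕ}
    (hχ : ∀ r ∈ augIdeal G ^ (n + 1), extendFun χ r = 0) (g : ι → G) (z : ι → ℤ) :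
    χ (∑ i, z i • g i) = ∑ α ∈ Fintype.piFinset fun _ : ι => Finset.range (n + 1),
      extendFun χ (∏ i, (AddMonoidAlgebra.single (g i) 1 - 1) ^ α i) *
        ∏ i, Ring.choose (z i) (α i) := by
  have h : extendFun χ (AddMonoidAlgebra.single (∑ i, z i • g i) 1) = extendFun χ
      (∑ α ∈ Fintype.piFinset fun _ : ι => Finset.range (n + 1),
        (∏ i, Ring.choose (z i) (α i)) •
          ∏ i, (AddMonoidAlgebra.single (g i) 1 - 1) ^ α i) := by
    refine extendFun_eq_of_mk_eq hχ ?_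
    rw [single_sum, map_prod]
    simp only [mk_single_zsmul, Finset.prod_univ_sum, map_sum, map_zsmul, map_prod, map_pow,
      Finset.prod_smul]
  rw [extendFun_single, one_mul] at h
  rw [h, map_sum]
  simp only [map_zsmul, smul_eq_mul, mul_comm]

end Binomial

/-! ### Rational polynomials in several variables -/

section RatPolynomial

open MvPolynomial

variable {ι : Type*}

/-- The binomial coefficient `x_i (x_i - 1) ⋯ (x_i - k + 1) / k!` as a polynomial. -/
noncomputable def binomialPoly (i : ι) (k : ℕ) : MvPolynomial ι ℚ :=
  C (k.factorial : ℚ)⁻¹ * ∏ j ∈ Finset.range k, (X i - C (j : ℚ))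

lemma totalDegree_binomialPoly_le (i : ι) (k : ℕ) : (binomialPoly i k).totalDegree ≤ k := by
  refine (totalDegree_mul _ _).trans ?_
  rw [totalDegree_C, zero_add]
  refine (totalDegree_finsetProd _ _).trans ?_
  calc _ ≤ ∑ j ∈ Finset.range k, 1 := Finset.sum_le_sum fun j _ => by
        refine (totalDegree_sub_C_le _ _).trans ?_
        rw [totalDegree_X]
    _ = k := by simp

lemma choose_eq_descPochhammer_eval (z : ℤ) (k : ℕ) :
    ((Ring.choose z k : ℤ) : ℚ) = (k.factorial : ℚ)⁻¹ * ∏ j ∈ Finset.range k, ((z : ℚ) - j) := by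
  have h := Ring.descPochhammer_eq_factorial_smul_choose z k
  rw [← Polynomial.eval_eq_smeval, descPochhammer_eval_eq_prod_range, nsmul_eq_mul] at h
  have h' := congrArg (Int.cast : ℤ → ℚ) h
  push_cast at h'
  rw [h', inv_mul_cancel_left₀ (by positivity)]

lemma eval_binomialPoly (z : ι → ℤ) (i : ι) (k : ℕ) :
    eval (fun i => (z i : ℚ)) (binomialPoly i k) = (Ring.choose (z i) k : ℤ) := by
  rw [choose_eq_descPochhammer_eval, binomialPoly, map_mul, map_prod]
  simp

lemma eval_smul_of_isHomogeneous {p : MvPolynomial ι ℚ} {n : ℕ} (hp : p.IsHomogeneous n)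
    (t : ℚ) (z : ι → ℚ) : eval (fun i => t * z i) p = eval z p * t ^ n := by
  rw [p.as_sum, map_sum, map_sum, Finset.sum_mul]
  refine Finset.sum_congr rfl fun α hα => ?_
  have hk : α.degree = n := by
    by_contra h
    exact (mem_support_iff.1 hα) (hp.coeff_eq_zero h)
  rw [eval_monomial, eval_monomial, mul_assoc, ← hk, Finsupp.degree_apply,
    ← Finset.prod_pow_eq_pow_sum, Finsupp.prod, Finsupp.prod, ← Finset.prod_mul_distrib]
  simp only [mul_pow, mul_comm]

/-- Restriction to the line through z turns homogeneous components into coefficients, so the top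
part of the Ehrhart polynomial can be found in one variable. -/
lemma exists_polynomial_eval_mul (p : MvPolynomial ι ℚ) (z : ι → ℚ) :
    ∃ q : Polynomial ℚ, (∀ t : ℚ, q.eval t = eval (fun i => t * z i) p) ∧
      ∀ d, q.coeff d = eval z (homogeneousComponent d p) := by
  refine ⟨∑ i ∈ Finset.range (p.totalDegree + 1),
    Polynomial.monomial i (eval z (homogeneousComponent i p)), fun t => ?_, fun d => ?_⟩
  · rw [Polynomial.eval_finsetSum]
    conv_rhs => rw [← sum_homogeneousComponent p, map_sum]
    refine Finset.sum_congr rfl fun i _ => ?_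
    rw [Polynomial.eval_monomial,
      eval_smul_of_isHomogeneous (homogeneousComponent_isHomogeneous i p)]
  · rw [Polynomial.finsetSum_coeff]
    simp only [Polynomial.coeff_monomial]
    rw [Finset.sum_ite_eq']
    split_ifs with h
    · rfl
    · rw [homogeneousComponent_eq_zero, map_zero]
      simpa using h

lemma eq_of_eval_int_eq {p q : MvPolynomial ι ℚ}
    (h : ∀ z : ι → ℤ, eval (fun i => (z i : ℚ)) p = eval (fun i => (z i : ℚ)) q) : p = q := by
  refine funext_set (fun _ => Set.range (Int.cast : ℤ → ℚ))
    (fun _ => Set.infinite_range_of_injective Int.cast_injective) fun x hx => ?_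
  choose z hz using fun i => hx i (Set.mem_univ i)
  rw [← funext hz]
  exact h z

/-- Each monomial of p misses some variable i of `T`, and the terms of S and S ∪ {i} then cancel.
The alternating sum is an iterated backward difference at 0. -/
lemma sum_powerset_neg_one_pow_mul_eval [DecidableEq ι] {p : MvPolynomial ι ℚ} {T : Finset ι}
    (h : p.totalDegree < T.card) :
    ∑ S ∈ T.powerset, (-1) ^ S.card * eval (fun i => if i ∈ S then (-1 : ℚ) else 0) p = 0 := by
  have hexp : ∀ S : Finset ι, (-1) ^ S.card * eval (fun i => if i ∈ S then (-1 : ℚ) else 0) p =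
      ∑ α ∈ p.support, (-1) ^ S.card *
        eval (fun i => if i ∈ S then (-1 : ℚ) else 0) (monomial α (coeff α p)) := by
    intro S
    conv_lhs => rw [p.as_sum, map_sum, Finset.mul_sum]
  simp only [hexp]
  rw [Finset.sum_comm]
  refine Finset.sum_eq_zero fun α hα => ?_
  have hlt : α.support.card < T.card :=
    ((card_support_le_degree α).trans (le_totalDegree hα)).trans_lt h
  obtain ⟨i, hiT, hiα⟩ := Finset.exists_mem_notMem_of_card_lt_card hlt
  rw [← Finset.insert_erase hiT, Finset.sum_powerset_insert (Finset.notMem_erase i T),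
    ← Finset.sum_add_distrib]
  refine Finset.sum_eq_zero fun S hS => ?_
  have hiS : i ∉ S := fun hi => Finset.notMem_erase i T (Finset.mem_powerset.1 hS hi)
  rw [Finset.card_insert_of_notMem hiS, eval_monomial, eval_monomial]
  have hprod : α.prod (fun j k => (if j ∈ insert i S then (-1 : ℚ) else 0) ^ k) =
      α.prod (fun j k => (if j ∈ S then (-1 : ℚ) else 0) ^ k) := by
    refine Finset.prod_congr rfl fun j hj => ?_
    have hji : j ≠ i := fun he => hiα (he ▸ hj)
    simp [hji]
  rw [hprod]
  ring

end RatPolynomial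

/-! ### Ehrhart polynomials are polynomials -/

section Main

variable {N : Type u} [AddCommGroup N] {F : Set (Set (RealSpace N))}

open MvPolynomial

theorem IsEhrhartPolynomial.exists_represents {χ : UPL F → ℤ} (hχ : IsEhrhartPolynomial F χ)
    (hF : IsUnimodularFan F) {d : ℕ} (hd : ∀ σ ∈ F, coneDim σ ≤ d) :
    ∃ P : MvPolynomial (Ray F) ℚ, P.totalDegree ≤ d ∧ Represents hF P fun q => (χ q : ℚ) := by
  classical
  have := hF.toIsRationalFan.finite_ray
  have := Fintype.ofFinite (Ray F)
  have hvan : ∀ r ∈ augIdeal (UPL F) ^ (d + 1), extendFun χ r = 0 := fun r hr =>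
    hχ.extendFun_eq_zero hd hr
  let c : (Ray F → ℕ) → ℤ := fun α => extendFun χ
    (∏ ρ, (AddMonoidAlgebra.single (cls (courant hF ρ)) 1 - 1) ^ α ρ)
  refine ⟨∑ α ∈ Fintype.piFinset fun _ : Ray F => Finset.range (d + 1),
    C (c α : ℚ) * ∏ ρ, binomialPoly ρ (α ρ), ?_, fun f => ?_⟩
  · refine totalDegree_finsetSum_le fun α _ => ?_
    -- The exponents range over a box, so some have sum greater than d. Their coefficients are
    -- values of χ on I^(d+1), hence 0.
    by_cases hα : ∑ ρ, α ρ ≤ d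
    · refine (totalDegree_mul _ _).trans ?_
      rw [totalDegree_C, zero_add]
      exact (totalDegree_finsetProd _ _).trans
        ((Finset.sum_le_sum fun ρ _ => totalDegree_binomialPoly_le ρ (α ρ)).trans hα)
    · have h0 : c α = 0 := by
        refine hvan _ (Ideal.pow_le_pow_right (by omega : d + 1 ≤ ∑ ρ, α ρ) ?_)
        exact prod_pow_mem_pow_sum _ (fun _ => single_sub_one_mem_augIdeal _) α
      rw [h0, Int.cast_zero, C_0, zero_mul, totalDegree_zero]
      exact Nat.zero_le d
  · have hf : cls f = ∑ ρ, rayValue hF f ρ • cls (courant hF ρ) := by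
      conv_lhs => rw [eq_sum_rayValue_smul_courant hF f]
      rw [map_sum]
      simp only [map_zsmul]
    change _ = ((χ (cls f) : ℤ) : ℚ)
    rw [hf, apply_sum_zsmul_eq_sum_choose hvan, map_sum]
    push_cast
    refine Finset.sum_congr rfl fun α _ => ?_
    rw [map_mul, map_prod, eval_C]
    simp only [eval_binomialPoly, c]

lemma Represents.unique {hF : IsUnimodularFan F} {χ : UPL F → ℚ} {P Q : MvPolynomial (Ray F) ℚ}
    (hP : Represents hF P χ) (hQ : Represents hF Q χ) : P = Q := by
  refine eq_of_eval_int_eq fun z => ?_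
  obtain ⟨f, hf, -⟩ := existsUnique_rayValue hF z
  have := (hP f).trans (hQ f).symm
  simpa only [hf] using this

lemma rayValue_sum {ι : Type*} (hF : IsUnimodularFan F) (s : Finset ι) (f : ι → PL F) (ρ : Ray F) :
    rayValue hF (∑ i ∈ s, f i) ρ = ∑ i ∈ s, rayValue hF (f i) ρ := by
  let v : PL F →+ (Ray F → ℤ) := AddMonoidHom.mk' (rayValue hF) (rayValue_add hF)
  change v (∑ i ∈ s, f i) ρ = ∑ i ∈ s, v (f i) ρ
  rw [map_sum, Finset.sum_apply]

lemma rayValue_neg (hF : IsUnimodularFan F) (f : PL F) (ρ : Ray F) :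
    rayValue hF (-f) ρ = -rayValue hF f ρ := by
  let v : PL F →+ (Ray F → ℤ) := AddMonoidHom.mk' (rayValue hF) (rayValue_add hF)
  change v (-f) ρ = -v f ρ
  rw [map_neg, Pi.neg_apply]

lemma rayValue_zsmul (hF : IsUnimodularFan F) (t : ℤ) (f : PL F) (ρ : Ray F) :
    rayValue hF (t • f) ρ = t * rayValue hF f ρ := by
  let v : PL F →+ (Ray F → ℤ) := AddMonoidHom.mk' (rayValue hF) (rayValue_add hF)
  change v (t • f) ρ = t * v f ρ
  rw [map_zsmul, Pi.smul_apply, smul_eq_mul]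

/-- By uniqueness, `deg` is the map built from χ. The linear form of f goes to [f] - 1 modulo I², so
the d-th powers agree modulo I^(d+1), which χ does not see. -/
lemma IsEhrhartPolynomial.volumePolynomial_eq {χ : UPL F → ℤ} (hχ : IsEhrhartPolynomial F χ)
    {hF : IsUnimodularFan F} {d : ℕ} (hd : ∀ σ ∈ F, coneDim σ ≤ d) {deg : chowPiece hF d →+ ℤ}
    (hdeg : IsDegreeMap hF d deg) (f : PL F) :
    volumePolynomial hF d deg (cls f) =
      extendFun χ ((AddMonoidAlgebra.single (cls f) 1 - 1) ^ d) := by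
  obtain ⟨deg', hdeg', h⟩ := hχ.exists_degreeMap hF hd
  obtain rfl := hdeg'.unique hdeg
  have hp := (linearPoly_isHomogeneous (rayValue hF f)).pow d
  rw [one_mul] at hp
  have h1 := h _ hp
  have h2 := hχ.extendFun_eq_zero hd (pow_sub_pow_mem (diffHom_linearPoly hF f)
    (single_sub_one_mem_augIdeal _) d)
  rw [map_sub, sub_eq_zero, ← map_pow (diffHom hF)] at h2
  rw [← h2, ← h1]
  refine congrArg deg' (Subtype.ext ?_)
  exact (map_pow (chowMk hF) (linearPoly (rayValue hF f)) d).symm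

theorem IsEhrhartPolynomial.represents_homogeneousComponent {χ : UPL F → ℤ}
    (hχ : IsEhrhartPolynomial F χ) {hF : IsUnimodularFan F} {d : ℕ}
    (hd : ∀ σ ∈ F, coneDim σ ≤ d) {deg : chowPiece hF d →+ ℤ} (hdeg : IsDegreeMap hF d deg)
    {P : MvPolynomial (Ray F) ℚ} (hP : Represents hF P fun q => (χ q : ℚ)) :
    Represents hF (homogeneousComponent d P)
      fun q => (1 / (d.factorial : ℚ)) * (volumePolynomial hF d deg q : ℚ) := by
  intro f
  change _ = 1 / (d.factorial : ℚ) * (volumePolynomial hF d deg (cls f) : ℚ)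
  rw [hχ.volumePolynomial_eq hd hdeg]
  set a : ℕ → ℤ := fun k => extendFun χ ((AddMonoidAlgebra.single (cls f) 1 - 1) ^ k)
  obtain ⟨q, hq, hcoeff⟩ := exists_polynomial_eval_mul P fun ρ => (rayValue hF f ρ : ℚ)
  -- The restriction to the line agrees with the binomial expansion of χ(t f) at all integers t,
  -- hence as a polynomial. Only k = d contributes to t^d, and the falling factorial is monic, so
  -- the coefficient is `a d` divided by d!.
  have hqB : q = ∑ k ∈ Finset.range (d + 1),
      Polynomial.C ((k.factorial : ℚ)⁻¹ * a k) * descPochhammer ℚ k := by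
    refine Polynomial.eq_of_infinite_eval_eq _ _
      ((Set.infinite_range_of_injective (Int.cast_injective (α := ℚ))).mono ?_)
    rintro _ ⟨t, rfl⟩
    have h1 := hP (t • f)
    simp only [rayValue_zsmul, Int.cast_mul, map_zsmul,
      apply_zsmul_eq_sum_choose (fun r hr => hχ.extendFun_eq_zero hd hr)] at h1
    rw [Set.mem_ofPred_eq, hq, h1, Polynomial.eval_finsetSum]
    push_cast
    refine Finset.sum_congr rfl fun k _ => ?_
    rw [Polynomial.eval_mul, Polynomial.eval_C, descPochhammer_eval_eq_prod_range,
      choose_eq_descPochhammer_eval]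
    ring
  rw [← hcoeff, hqB, Polynomial.finsetSum_coeff, Finset.sum_range_succ, Finset.sum_eq_zero,
    zero_add, Polynomial.coeff_C_mul]
  · have h1 := (monic_descPochhammer ℚ d).coeff_natDegree
    rw [descPochhammer_natDegree] at h1
    rw [h1, mul_one, one_div]
  · intro k hk
    rw [Polynomial.coeff_C_mul, Polynomial.coeff_eq_zero_of_natDegree_lt, mul_zero]
    rw [descPochhammer_natDegree]
    exact Finset.mem_range.1 hk

/-- Expanding the product of the differences 1 - [-δ_ρ] over `T` gives the alternating sum of the
values of P at the points equal to -1 on S and 0 elsewhere. It equals 1, yet it would be 0 if the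
degree of P were below the size of `T`. -/
theorem IsEhrhartPolynomial.card_le_totalDegree {χ : UPL F → ℤ} (hχ : IsEhrhartPolynomial F χ)
    {hF : IsUnimodularFan F} {P : MvPolynomial (Ray F) ℚ}
    (hP : Represents hF P fun q => (χ q : ℚ)) {T : Finset (Ray F)}
    (hT : ∃ σ ∈ F, ∀ ρ ∈ T, ρ.1 ⊆ σ) : T.card ≤ P.totalDegree := by
  classical
  by_contra! hlt
  have h1 := hχ.extendFun_prod_eq_one hF T hT
  have hval : ∀ S : Finset (Ray F), extendFun χ ((-1) ^ S.card *
      ∏ ρ ∈ S, AddMonoidAlgebra.single (-cls (courant hF ρ)) 1) =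
        (-1) ^ S.card * χ (cls (-∑ ρ ∈ S, courant hF ρ)) := by
    intro S
    have e : (-1 : AddMonoidAlgebra ℤ (UPL F)) ^ S.card *
        AddMonoidAlgebra.single (∑ ρ ∈ S, -cls (courant hF ρ)) 1 =
          ((-1 : ℤ) ^ S.card) • AddMonoidAlgebra.single (∑ ρ ∈ S, -cls (courant hF ρ)) 1 := by
      rw [zsmul_eq_mul]
      push_cast
      rfl
    rw [← single_sum, e, map_zsmul, extendFun_single, one_mul, smul_eq_mul,
      Finset.sum_neg_distrib, map_neg, map_sum]
  simp only [diffElt] at h1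
  rw [Finset.prod_sub, map_sum] at h1
  simp only [Finset.prod_const_one, mul_one, hval] at h1
  have h2 := sum_powerset_neg_one_pow_mul_eval hlt
  have h3 : ∀ S : Finset (Ray F), eval (fun ρ => if ρ ∈ S then (-1 : ℚ) else 0) P =
      χ (cls (-∑ ρ ∈ S, courant hF ρ)) := by
    intro S
    refine Eq.trans ?_ (hP (-∑ ρ ∈ S, courant hF ρ))
    refine congrArg (fun z => eval z P) (funext fun ρ => ?_)
    rw [rayValue_neg, rayValue_sum]
    simp only [rayValue_courant, Finset.sum_ite_eq]
    split_ifs <;> simp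
  simp only [h3] at h2
  have h4 : ((1 : ℤ) : ℚ) = 0 := by
    rw [← h1, ← h2]
    push_cast
    rfl
  norm_num at h4

lemma coneDim_le_fanDim (hF : IsRationalFan F) {σ : Set (RealSpace N)} (hσ : σ ∈ F) :
    coneDim σ ≤ fanDim F :=
  le_csSup (hF.finite.image _).bddAbove ⟨σ, hσ, rfl⟩

lemma exists_coneDim_eq_fanDim (hF : IsUnimodularFan F) : ∃ σ ∈ F, coneDim σ = fanDim F :=
  Nat.sSup_mem (Set.Nonempty.image _ ⟨_, hF.pointed⟩) (hF.finite.image _).bddAbove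

end Main

end EhrhartFan

/-! ### The main theorem -/

theorem mainTheorem9 {N : Type u} [AddCommGroup N] [Module.Free ℤ N] [Module.Finite ℤ N]
    (F : Set (Set (EhrhartFan.RealSpace N))) (hF : EhrhartFan.IsUnimodularFan F)
    (χ : EhrhartFan.UPL F → ℤ) (hχ : EhrhartFan.IsEhrhartPolynomial F χ)
    (d : ℕ) (hd : EhrhartFan.fanDim F = d) :
    (∃! deg : EhrhartFan.chowPiece hF d →+ ℤ, EhrhartFan.IsDegreeMap hF d deg) ∧
    (∃! P : MvPolynomial (EhrhartFan.Ray F) ℚ,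
      EhrhartFan.Represents hF P (fun q => (χ q : ℚ))) ∧
    ∀ deg : EhrhartFan.chowPiece hF d →+ ℤ, EhrhartFan.IsDegreeMap hF d deg →
      ∀ P : MvPolynomial (EhrhartFan.Ray F) ℚ,
        EhrhartFan.Represents hF P (fun q => (χ q : ℚ)) →
          P.totalDegree = d ∧
          EhrhartFan.Represents hF (MvPolynomial.homogeneousComponent d P)
            (fun q => (1 / (d.factorial : ℚ)) * (EhrhartFan.volumePolynomial hF d deg q : ℚ)) := by
  classical
  have hle : ∀ σ ∈ F, EhrhartFan.coneDim σ ≤ d := fun σ hσ =>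
    hd ▸ EhrhartFan.coneDim_le_fanDim hF.toIsRationalFan hσ
  obtain ⟨deg₀, hdeg₀, -⟩ := hχ.exists_degreeMap hF hle
  obtain ⟨P₀, hP₀d, hP₀⟩ := hχ.exists_represents hF hle
  refine ⟨⟨deg₀, hdeg₀, fun _ h => h.unique hdeg₀⟩, ⟨P₀, hP₀, fun _ h => h.unique hP₀⟩,
    fun deg hdeg P hP => ⟨le_antisymm ?_ ?_, hχ.represents_homogeneousComponent hle hdeg hP⟩⟩
  · rwa [hP.unique hP₀]
  -- A cone of maximal dimension has exactly d rays, and these give the lower bound for the degree.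
  · obtain ⟨σ, hσ, hσd⟩ := EhrhartFan.exists_coneDim_eq_fanDim hF
    have := hF.toIsRationalFan.finite_ray
    have := Fintype.ofFinite (EhrhartFan.Ray F)
    have hT : ∀ ρ, ρ ∈ (Finset.univ.filter fun ρ : EhrhartFan.Ray F => ρ.1 ⊆ σ) ↔ ρ.1 ⊆ σ := by
      simp
    rw [← hd, ← hσd, ← EhrhartFan.card_rays_eq_coneDim hF hσ hT]
    exact hχ.card_le_totalDegree hP ⟨σ, hσ, fun ρ hρ => (hT ρ).1 hρ⟩
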